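/- Let $\mathrm{C}=(\mathrm{C},\otimes,e)$ be a symmetric monoidal category that has all finite limits and whose tensor product preserves finite limits in each variable (for instance a small, complete and continuous one); strictness is not assumed. Let $\operatorname{Mor}(\mathrm C)$ be the set of arrows of $\mathrm C$ up to isomorphism in the arrow category (commutative squares with two invertible sides). **Operads.** For $n\ge 1$ let $\mathsf{scpx}_{\neq\emptyset}(n)$ be the set of non-empty families $K$ of subsets of $[n]$ that are closed under taking subsets, with the right action $K\cdot\sigma=\{\sigma^{-1}(I)\mid I\in K\}$ of the symmetric group $\mathbb S_n$ (there are no operations of arity $0$). For $I\subseteq[n]$, $J\subseteq[m]$ and $k\in[n]$ write $I^{<k}$, $I^{>k}$ for the sets of elements of $I$ that are $<k$, resp. $>k$, and put $$I\circ_k J=\begin{cases} I^{<k}\sqcup(J+k-1)\sqcup(I^{>k}+m-1)& k\in I,\\ I^{<k}\sqcup(I^{>k}+m-1)& k\notin I,\end{cases}\qquad I\circ^c_k J=\begin{cases} I^{<k}\sqcup([m]+k-1)\sqcup(I^{>k}+m-1)& k\in I,\\ I^{<k}\sqcup(J+k-1)\sqcup(I^{>k}+m-1)& k\notin I.\end{cases}$$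 The substitution operad has partial compositions $K\circ_k L=\{I\circ_k J\mid I\in K,J\in L\}$ and unit $\{\emptyset,\{1\}\}$; the composition operad has partial compositions $K\circ^c_k L=\{X\mid X\subseteq I\circ^c_k J\text{ for some }I\in K,J\in L\}$ and unit $\{\emptyset\}$ on $[1]$. An algebra structure on a set $S$ over an operad $\mathcal O$ is a morphism of unital symmetric operads from $\mathcal O$ to the endomorphism operad $\mathcal O'(n)=\operatorname{Hom}(S^n,S)$. **Polyhedral limits.** For $\underline f=(f_i\colon Y_i\to X_i)_{i\in[n]}$ let $z_n(-;\underline f)\colon(\wp([n]),\subseteq)\to\mathrm C$ be the cubical functor: $z_n(I;\underline f)$ is the ordered tensor product over $i=1,\dots,n$ of the $X_i$ for $i\in I$ and the $Y_i$ for $i\notin I$, and an inclusion $I\subseteq J$ is sent to the tensor product of the $f_i$ for $i\in J\setminus I$ and of identities elsewhere. For $K\in\mathsf{scpx}_{\neq\emptyset}(n)$, viewed as a poset $\operatorname{cat}(K)$ under inclusion, $I\mapsto z_n([n]\setminus I;\underline f)$ is a functor $\operatorname{cat}(K)^{\mathrm{op}}\to\mathrm C$. Put $$\overrightarrow{\mathcal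 L}_n(K;\underline f)=\Bigl(\lim_{I\in\operatorname{cat}(K)^{\mathrm{op}}}z_n([n]\setminus I;\underline f)\to z_n([n];\underline f)=\bigotimes_{i=1}^n X_i\Bigr),$$ the projection to the value at the face $\emptyset$, and $$\overrightarrow{\mathcal L}^c_n(K;\underline f)=\Bigl(\bigotimes_{i=1}^n Y_i=z_n(\emptyset;\underline f)\to\lim_{I\in\operatorname{cat}(K)^{\mathrm{op}}}z_n([n]\setminus I;\underline f)\Bigr),$$ the arrow with components $z_n(\emptyset\subseteq[n]\setminus I;\underline f)$. **Theorem.** (i) $\operatorname{Mor}(\mathrm C)$ carries an algebra structure over the substitution operad on non-empty complexes, whose structure maps send $(K;[f_1],\dots,[f_n])$ to the class of $\overrightarrow{\mathcal L}_n(K;\underline f)$. (ii) $\operatorname{Mor}(\mathrm C)$ carries an algebra structure over the composition operad on non-empty complexes, whose structure maps send $(K;[f_1],\dots,[f_n])$ to the class of $\overrightarrow{\mathcal L}^c_n(K;\underline f)$. (iii) Suppose moreover that $\mathrm C$ is strict monoidal (associators and unitors are identities). Then for all $K\in\mathsf{scpx}_{\neq\emptyset}(n)$, $L\in\mathsf{scpx}_{\neq\emptyset}(m)$,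 $k\in[n]$ and $\underline f=(f_1,\dots,f_{n+m-1})$, the arrows $$\overrightarrow{\mathcal L}_{n+m-1}(K\circ_kL;\underline f)\quad\text{and}\quad\overrightarrow{\mathcal L}_n\bigl(K;f_1,\dots,f_{k-1},\overrightarrow{\mathcal L}_m(L;f_k,\dots,f_{k+m-1}),f_{k+m},\dots,f_{n+m-1}\bigr)$$ have the same codomain and are isomorphic over it, and so are $\overrightarrow{\mathcal L}_1(\{\emptyset,\{1\}\};f)$ and $f$, for every arrow $f$; the same formulas with $\overrightarrow{\mathcal L}^c$, $\circ^c_k$ and the unit $\{\emptyset\}$ give arrows that have the same domain and are isomorphic under it. -/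

import Mathlib

open CategoryTheory CategoryTheory.Limits MonoidalCategory Opposite

universe u v w

namespace PolyLim

/-! ### Positions in a partial composition

Arities are modelled on `Fin n`, so positions are numbered from `0`.  Inserting an operation of
arity `m` at position `k` of an operation of arity `n` gives an operation of arity
`N = n + m - 1`; we carry `N` together with a proof of `N + 1 = n + m`, so that no transport along
equalities of arities is ever needed. -/

/-- The position, after insertion at `k`, of the `j`-th input of the inserted operation:
`j ↦ j + k` (this is `j + k - 1` when positions are numbered from `1`). -/
def innerPos {n m N : ℕ} (k : Fin n) (h : N + 1 = n + m) (j : Fin m) : Fin N :=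
  ⟨k + j, by omega⟩

/-- The position, after insertion at `k`, of the `i`-th input (`i ≠ k`) of the outer operation:
`i ↦ i` for `i < k` and `i ↦ i + m - 1` for `i > k`. -/
def outerPos {n m N : ℕ} (k : Fin n) (h : N + 1 = n + m) (i : Fin n) (hi : i ≠ k) : Fin N :=
  ⟨if i < k then i else i + m - 1, by
    have := Fin.val_ne_of_ne hi
    split_ifs with hlt
    · have : (i : ℕ) < k := hlt
      omega
    · have : ¬ (i : ℕ) < k := hlt
      omega⟩

section positions

variable {n m N : ℕ} {k : Fin n} {h : N + 1 = n + m}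

theorem inner_injective {j j' : Fin m} (e : innerPos k h j = innerPos k h j') : j = j' := by
  simp only [innerPos, Fin.mk.injEq] at e
  exact Fin.ext (by omega)

theorem outer_injective {i i' : Fin n} {hi : i ≠ k} {hi' : i' ≠ k}
    (e : outerPos k h i hi = outerPos k h i' hi') : i = i' := by
  simp only [outerPos, Fin.mk.injEq, Fin.lt_def] at e
  have h1 := Fin.val_ne_of_ne hi
  have h2 := Fin.val_ne_of_ne hi'
  apply Fin.ext
  split_ifs at e <;> omega

theorem outer_ne_inner {i : Fin n} {hi : i ≠ k} {j : Fin m} :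
    outerPos k h i hi ≠ innerPos k h j := by
  intro e
  simp only [outerPos, innerPos, Fin.mk.injEq, Fin.lt_def] at e
  have h1 := Fin.val_ne_of_ne hi
  split_ifs at e <;> omega

theorem outer_or_inner (k : Fin n) (h : N + 1 = n + m) (x : Fin N) :
    (∃ i hi, outerPos k h i hi = x) ∨ ∃ j, innerPos k h j = x := by
  rcases lt_trichotomy (x : ℕ) k with hx | hx | hx
  · refine Or.inl ⟨⟨x, by omega⟩, fun e => ?_, ?_⟩
    · have := congrArg Fin.val e
      simp only at this
      omega
    · simp [outerPos, Fin.lt_def, hx]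
  · by_cases hm : m = 0
    · refine Or.inl ⟨⟨x + 1, by omega⟩, fun e => ?_, ?_⟩
      · have := congrArg Fin.val e
        simp only at this
        omega
      · apply Fin.ext
        simp only [outerPos, Fin.lt_def]
        split_ifs <;> omega
    · exact Or.inr ⟨⟨0, by omega⟩, Fin.ext (by simp [innerPos, hx])⟩
  · by_cases hm : (x : ℕ) < k + m
    · exact Or.inr ⟨⟨x - k, by omega⟩, Fin.ext (by simp only [innerPos]; omega)⟩
    · refine Or.inl ⟨⟨x + 1 - m, by omega⟩, fun e => ?_, ?_⟩
      · have := congrArg Fin.val e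
        simp only at this
        omega
      · apply Fin.ext
        simp only [outerPos, Fin.lt_def]
        split_ifs <;> omega

end positions

section iterated

variable {l n m P Q N : ℕ}

theorem outer_outer {i j a : Fin l} (hij : i ≠ j) (hai : a ≠ i) (haj : a ≠ j)
    (hP : P + 1 = l + n) (hQ : Q + 1 = l + m) (hPN : N + 1 = P + m) (hQN : N + 1 = Q + n)
    (h1 : outerPos i hP a hai ≠ outerPos i hP j hij.symm) (h2 : outerPos j hQ a haj ≠ outerPos j hQ i hij) :
    outerPos (outerPos i hP j hij.symm) hPN (outerPos i hP a hai) h1 =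
      outerPos (outerPos j hQ i hij) hQN (outerPos j hQ a haj) h2 := by
  have h3 := Fin.val_ne_of_ne hij
  have h4 := Fin.val_ne_of_ne hai
  have h5 := Fin.val_ne_of_ne haj
  apply Fin.ext
  simp only [outerPos, Fin.lt_def]
  split_ifs <;> omega

theorem outer_inner {i j : Fin l} {b : Fin n} (hij : i ≠ j)
    (hP : P + 1 = l + n) (hQ : Q + 1 = l + m) (hPN : N + 1 = P + m) (hQN : N + 1 = Q + n)
    (h1 : innerPos i hP b ≠ outerPos i hP j hij.symm) :
    outerPos (outerPos i hP j hij.symm) hPN (innerPos i hP b) h1 = innerPos (outerPos j hQ i hij) hQN b := by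
  have h3 := Fin.val_ne_of_ne hij
  apply Fin.ext
  simp only [outerPos, innerPos, Fin.lt_def]
  split_ifs <;> omega

theorem seq_outer {i a : Fin l} {j : Fin n} (hai : a ≠ i)
    (hP : P + 1 = l + n) (hQ : Q + 1 = n + m) (hPN : N + 1 = P + m) (hQN : N + 1 = l + Q)
    (h1 : outerPos i hP a hai ≠ innerPos i hP j) :
    outerPos (innerPos i hP j) hPN (outerPos i hP a hai) h1 = outerPos i hQN a hai := by
  have h3 := Fin.val_ne_of_ne hai
  apply Fin.ext
  simp only [outerPos, innerPos, Fin.lt_def]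
  split_ifs <;> omega

theorem seq_inner_outer {i : Fin l} {j b : Fin n} (hbj : b ≠ j)
    (hP : P + 1 = l + n) (hQ : Q + 1 = n + m) (hPN : N + 1 = P + m) (hQN : N + 1 = l + Q)
    (h1 : innerPos i hP b ≠ innerPos i hP j) :
    outerPos (innerPos i hP j) hPN (innerPos i hP b) h1 = innerPos i hQN (outerPos j hQ b hbj) := by
  have h3 := Fin.val_ne_of_ne hbj
  apply Fin.ext
  simp only [outerPos, innerPos, Fin.lt_def]
  split_ifs <;> omega

theorem seq_inner_inner {i : Fin l} {j : Fin n} {c : Fin m}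
    (hP : P + 1 = l + n) (hQ : Q + 1 = n + m) (hPN : N + 1 = P + m) (hQN : N + 1 = l + Q) :
    innerPos (innerPos i hP j) hPN c = innerPos i hQN (innerPos j hQ c) := by
  apply Fin.ext
  simp only [innerPos]
  omega

end iterated

/-! ### Symmetric set operads and their algebras -/

/-- A unital symmetric operad in sets, presented by its partial compositions.  `act` is the right
action of the symmetric groups, and `comp k h A B` is the partial composition `A ∘ₖ B`. -/
structure SetOperad where
  Op : ℕ → Type w
  act : ∀ {n : ℕ}, Op n → Equiv.Perm (Fin n) → Op n
  one : Op 1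
  comp : ∀ {n m N : ℕ} (_ : Fin n) (_ : N + 1 = n + m), Op n → Op m → Op N
  act_one : ∀ {n : ℕ} (A : Op n), act A 1 = A
  act_mul : ∀ {n : ℕ} (A : Op n) (σ τ : Equiv.Perm (Fin n)), act A (σ * τ) = act (act A σ) τ
  /-- Compatibility with the symmetric groups: `ρ` is the block permutation that moves the blocks
  of inputs by `σ` and the inputs inside the inserted block by `τ`. -/
  act_comp : ∀ {n m N : ℕ} (k : Fin n) (h : N + 1 = n + m) (A : Op n) (B : Op m)
    (σ : Equiv.Perm (Fin n)) (τ : Equiv.Perm (Fin m)) (ρ : Equiv.Perm (Fin N)),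
    (∀ j, ρ (innerPos k h j) = innerPos (σ k) h (τ j)) →
    (∀ i (hi : i ≠ k), ρ (outerPos k h i hi) = outerPos (σ k) h (σ i) (σ.injective.ne hi)) →
    comp k h (act A σ) (act B τ) = act (comp (σ k) h A B) ρ
  one_comp : ∀ {n : ℕ} (h : n + 1 = 1 + n) (A : Op n), comp 0 h one A = A
  comp_one : ∀ {n : ℕ} (k : Fin n) (A : Op n), comp k rfl A one = A
  /-- Parallel axiom. -/
  parallel : ∀ {l n m P Q N : ℕ} (i j : Fin l) (hij : i ≠ j) (hP : P + 1 = l + n)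
    (hQ : Q + 1 = l + m) (hPN : N + 1 = P + m) (hQN : N + 1 = Q + n)
    (A : Op l) (B : Op n) (C : Op m),
    comp (outerPos i hP j hij.symm) hPN (comp i hP A B) C =
      comp (outerPos j hQ i hij) hQN (comp j hQ A C) B
  /-- Sequential axiom. -/
  sequential : ∀ {l n m P Q N : ℕ} (i : Fin l) (j : Fin n) (hP : P + 1 = l + n)
    (hQ : Q + 1 = n + m) (hPN : N + 1 = P + m) (hQN : N + 1 = l + Q)
    (A : Op l) (B : Op n) (C : Op m),
    comp (innerPos i hP j) hPN (comp i hP A B) C = comp i hQN A (comp j hQ B C)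

/-- Morphisms of (unital, symmetric) set operads. -/
structure SetOperad.Hom (P : SetOperad.{u}) (Q : SetOperad.{v}) where
  app : ∀ n : ℕ, P.Op n → Q.Op n
  app_act : ∀ {n : ℕ} (A : P.Op n) (σ : Equiv.Perm (Fin n)),
    app n (P.act A σ) = Q.act (app n A) σ
  app_one : app 1 P.one = Q.one
  app_comp : ∀ {n m N : ℕ} (k : Fin n) (h : N + 1 = n + m) (A : P.Op n) (B : P.Op m),
    app N (P.comp k h A B) = Q.comp k h (app n A) (app m B)

/-- The inputs of the outer operation in a partial composition at `k`: the value `y` is put at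
position `k`, and the other positions are filled, in order, with the entries of `x` outside the
inserted block, i.e. the sequence `x₁, …, xₖ₋₁, y, xₖ₊ₘ, …, xₙ₊ₘ₋₁`. -/
def graft {X : Type u} {n m N : ℕ} (k : Fin n) (h : N + 1 = n + m) (x : Fin N → X) (y : X) :
    Fin n → X :=
  fun i => if hi : i = k then y else x (outerPos k h i hi)

theorem graft_self {X : Type u} {n m N : ℕ} (k : Fin n) (h : N + 1 = n + m) (x : Fin N → X)
    (y : X) : graft k h x y k = y := by simp [graft]

theorem graft_ne {X : Type u} {n m N : ℕ} (k : Fin n) (h : N + 1 = n + m) (x : Fin N → X)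
    (y : X) {i : Fin n} (hi : i ≠ k) : graft k h x y i = x (outerPos k h i hi) := by
  simp [graft, hi]

/-- The endomorphism operad of a set: operations of arity `n` are maps `X ^ n → X`. -/
def endOperad (X : Type u) : SetOperad.{u} where
  Op n := (Fin n → X) → X
  act f σ := fun x => f (fun i => x (σ.symm i))
  one := fun x => x 0
  comp k h f g := fun x => f (graft k h x (g (fun j => x (innerPos k h j))))
  act_one f := rfl
  act_mul f σ τ := by
    rfl
  act_comp k h f g σ τ ρ h1 h2 := by
    funext x
    dsimp only
    congr 1
    funext i
    by_cases hi : i = σ k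
    · subst hi
      rw [Equiv.symm_apply_apply, graft_self, graft_self]
      congr 1
      funext j
      have := h1 (τ.symm j)
      rw [Equiv.apply_symm_apply] at this
      rw [← this, Equiv.symm_apply_apply]
    · have hi' : σ.symm i ≠ k := fun e => hi (by rw [← e, Equiv.apply_symm_apply])
      rw [graft_ne _ _ _ _ hi, graft_ne _ _ _ _ hi']
      have := h2 _ hi'
      simp only [Equiv.apply_symm_apply] at this
      rw [← this, Equiv.symm_apply_apply]
  one_comp h f := by
    funext x
    dsimp only
    rw [graft_self]
    congr 1
    funext j
    congr 1
    apply Fin.ext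
    simp [innerPos]
  comp_one k f := by
    funext x
    dsimp only
    congr 1
    funext i
    by_cases hi : i = k
    · subst hi
      rw [graft_self]
      congr 1
    · rw [graft_ne _ _ _ _ hi]
      congr 1
      apply Fin.ext
      simp [outerPos]
  parallel i j hij hP hQ hPN hQN A B C := by
    funext x
    dsimp only
    congr 1
    funext a
    have e1 : ∀ b, graft (outerPos i hP j hij.symm) hPN x
        (C fun c => x (innerPos (outerPos i hP j hij.symm) hPN c)) (innerPos i hP b) =
        x (innerPos (outerPos j hQ i hij) hQN b) := fun b => by
      rw [graft_ne _ _ _ _ outer_ne_inner.symm, outer_inner hij hP hQ hPN hQN]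
    have e2 : ∀ c, graft (outerPos j hQ i hij) hQN x
        (B fun b => x (innerPos (outerPos j hQ i hij) hQN b)) (innerPos j hQ c) =
        x (innerPos (outerPos i hP j hij.symm) hPN c) := fun c => by
      rw [graft_ne _ _ _ _ outer_ne_inner.symm, outer_inner hij.symm hQ hP hQN hPN]
    simp only [e1, e2]
    by_cases hai : a = i
    · subst hai
      rw [graft_self, graft_ne _ _ _ _ hij, graft_self]
    · by_cases haj : a = j
      · subst haj
        rw [graft_self, graft_ne _ _ _ _ hai, graft_self]
      · rw [graft_ne _ _ _ _ hai, graft_ne _ _ _ _ haj,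
          graft_ne _ _ _ _ (fun e => haj (outer_injective e)),
          graft_ne _ _ _ _ (fun e => hai (outer_injective e)),
          outer_outer hij hai haj hP hQ hPN hQN]
  sequential i j hP hQ hPN hQN A B C := by
    funext x
    dsimp only
    congr 1
    funext a
    by_cases hai : a = i
    · subst hai
      rw [graft_self, graft_self]
      congr 1
      funext b
      by_cases hbj : b = j
      · subst hbj
        rw [graft_self, graft_self]
        simp only [seq_inner_inner hP hQ hPN hQN]
      · rw [graft_ne _ _ _ _ hbj, graft_ne _ _ _ _ (fun e => hbj (inner_injective e)),
          seq_inner_outer hbj hP hQ hPN hQN]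
    · rw [graft_ne _ _ _ _ hai, graft_ne _ _ _ _ hai, graft_ne _ _ _ _ outer_ne_inner,
        seq_outer hai hP hQ hPN hQN]

/-- An algebra structure on the set `X` over the operad `P`: a morphism of operads from `P` to the
endomorphism operad of `X`. -/
abbrev SetOperad.Algebra (P : SetOperad.{u}) (X : Type v) := SetOperad.Hom P (endOperad X)

/-! ### Non-empty simplicial complexes and the two operads -/

/-- A non-empty simplicial complex on `n ≥ 1` (possibly ghost) vertices: a non-empty, downward
closed family of subsets of `Fin n`.  In particular the empty set is always a face. -/
@[ext]
structure SComplex (n : ℕ) where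
  faces : Set (Set (Fin n))
  down_closed : ∀ {I J : Set (Fin n)}, I ∈ faces → J ⊆ I → J ∈ faces
  nonempty : faces.Nonempty
  pos : 0 < n

theorem SComplex.empty_mem {n : ℕ} (K : SComplex n) : (∅ : Set (Fin n)) ∈ K.faces :=
  K.down_closed K.nonempty.some_mem (Set.empty_subset _)

/-- Right action of the symmetric group on complexes: the faces of `K · σ` are the `σ⁻¹(I)`, for
`I` a face of `K`. -/
def SComplex.act {n : ℕ} (K : SComplex n) (σ : Equiv.Perm (Fin n)) : SComplex n where
  faces := {I | σ '' I ∈ K.faces}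
  down_closed hI hJ := K.down_closed hI (Set.image_mono hJ)
  nonempty := ⟨∅, by simpa using K.empty_mem⟩
  pos := K.pos

/-- `I ∘ₖ J`: the elements of `I` other than `k`, moved to their new positions, together with the
shifted copy of `J` if `k ∈ I`. -/
def substFace {n m N : ℕ} (k : Fin n) (h : N + 1 = n + m) (I : Set (Fin n)) (J : Set (Fin m)) :
    Set (Fin N) :=
  {x | (∃ i hi, i ∈ I ∧ outerPos k h i hi = x) ∨ (k ∈ I ∧ ∃ j ∈ J, innerPos k h j = x)}

/-- `I ∘ᶜₖ J`: the elements of `I` other than `k`, moved to their new positions, together with the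
whole inserted block if `k ∈ I`, and with the shifted copy of `J` if `k ∉ I`. -/
def compFace {n m N : ℕ} (k : Fin n) (h : N + 1 = n + m) (I : Set (Fin n)) (J : Set (Fin m)) :
    Set (Fin N) :=
  {x | (∃ i hi, i ∈ I ∧ outerPos k h i hi = x) ∨ (k ∈ I ∧ ∃ j, innerPos k h j = x) ∨
    (k ∉ I ∧ ∃ j ∈ J, innerPos k h j = x)}

section faces

variable {n m N : ℕ} {k : Fin n} {h : N + 1 = n + m} {I : Set (Fin n)} {J : Set (Fin m)}

theorem outer_mem_substFace {i : Fin n} (hi : i ≠ k) :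
    outerPos k h i hi ∈ substFace k h I J ↔ i ∈ I := by
  constructor
  · rintro (⟨i', hi', h1, h2⟩ | ⟨-, j, -, h2⟩)
    · exact outer_injective h2 ▸ h1
    · exact absurd h2.symm outer_ne_inner
  · exact fun h1 => Or.inl ⟨i, hi, h1, rfl⟩

theorem inner_mem_substFace {j : Fin m} :
    innerPos k h j ∈ substFace k h I J ↔ k ∈ I ∧ j ∈ J := by
  constructor
  · rintro (⟨i', hi', h1, h2⟩ | ⟨h0, j, h1, h2⟩)
    · exact absurd h2 outer_ne_inner
    · exact ⟨h0, inner_injective h2 ▸ h1⟩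
  · exact fun h1 => Or.inr ⟨h1.1, j, h1.2, rfl⟩

theorem outer_mem_compFace {i : Fin n} (hi : i ≠ k) :
    outerPos k h i hi ∈ compFace k h I J ↔ i ∈ I := by
  constructor
  · rintro (⟨i', hi', h1, h2⟩ | ⟨-, j, h2⟩ | ⟨-, j, -, h2⟩)
    · exact outer_injective h2 ▸ h1
    · exact absurd h2.symm outer_ne_inner
    · exact absurd h2.symm outer_ne_inner
  · exact fun h1 => Or.inl ⟨i, hi, h1, rfl⟩

theorem inner_mem_compFace {j : Fin m} :
    innerPos k h j ∈ compFace k h I J ↔ k ∈ I ∨ j ∈ J := by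
  constructor
  · rintro (⟨i', hi', h1, h2⟩ | ⟨h0, j, h2⟩ | ⟨h0, j, h1, h2⟩)
    · exact absurd h2 outer_ne_inner
    · exact Or.inl h0
    · exact Or.inr (inner_injective h2 ▸ h1)
  · intro h1
    by_cases hk : k ∈ I
    · exact Or.inr (Or.inl ⟨hk, j, rfl⟩)
    · exact Or.inr (Or.inr ⟨hk, j, h1.resolve_left hk, rfl⟩)

theorem set_ext_positions (k : Fin n) (h : N + 1 = n + m) {A B : Set (Fin N)}
    (h1 : ∀ i hi, outerPos k h i hi ∈ A ↔ outerPos k h i hi ∈ B)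
    (h2 : ∀ j, innerPos k h j ∈ A ↔ innerPos k h j ∈ B) : A = B := by
  ext x
  obtain ⟨i, hi, rfl⟩ | ⟨j, rfl⟩ := outer_or_inner k h x
  · exact h1 i hi
  · exact h2 j

theorem compFace_mono {I' : Set (Fin n)} {J' : Set (Fin m)} (hI : I ⊆ I') (hJ : J ⊆ J') :
    compFace k h I J ⊆ compFace k h I' J' := by
  intro x hx
  obtain ⟨i, hi, rfl⟩ | ⟨j, rfl⟩ := outer_or_inner k h x
  · rw [outer_mem_compFace] at hx ⊢
    exact hI hx
  · rw [inner_mem_compFace] at hx ⊢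
    exact hx.imp (fun h => hI h) (fun h => hJ h)

theorem image_substFace {k : Fin n} {h : N + 1 = n + m} {σ : Equiv.Perm (Fin n)}
    {τ : Equiv.Perm (Fin m)} {ρ : Equiv.Perm (Fin N)}
    (h1 : ∀ j, ρ (innerPos k h j) = innerPos (σ k) h (τ j))
    (h2 : ∀ i (hi : i ≠ k), ρ (outerPos k h i hi) = outerPos (σ k) h (σ i) (σ.injective.ne hi))
    (I : Set (Fin n)) (J : Set (Fin m)) :
    ρ '' substFace k h I J = substFace (σ k) h (σ '' I) (τ '' J) := by
  apply Set.Subset.antisymm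
  · rintro _ ⟨x, hx, rfl⟩
    obtain ⟨i, hi, rfl⟩ | ⟨j, rfl⟩ := outer_or_inner k h x
    · rw [h2, outer_mem_substFace]
      exact Set.mem_image_of_mem _ ((outer_mem_substFace hi).1 hx)
    · rw [h1, inner_mem_substFace]
      have := inner_mem_substFace.1 hx
      exact ⟨Set.mem_image_of_mem _ this.1, Set.mem_image_of_mem _ this.2⟩
  · rintro x (⟨_, hi, ⟨i, hI, rfl⟩, rfl⟩ | ⟨hk, _, ⟨j, hJ, rfl⟩, rfl⟩)
    · have hi' : i ≠ k := fun e => hi (congrArg _ e)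
      exact ⟨outerPos k h i hi', (outer_mem_substFace hi').2 hI, h2 i hi'⟩
    · exact ⟨innerPos k h j,
        inner_mem_substFace.2 ⟨(Function.Injective.mem_set_image σ.injective).1 hk, hJ⟩, h1 j⟩

theorem image_compFace {k : Fin n} {h : N + 1 = n + m} {σ : Equiv.Perm (Fin n)}
    {τ : Equiv.Perm (Fin m)} {ρ : Equiv.Perm (Fin N)}
    (h1 : ∀ j, ρ (innerPos k h j) = innerPos (σ k) h (τ j))
    (h2 : ∀ i (hi : i ≠ k), ρ (outerPos k h i hi) = outerPos (σ k) h (σ i) (σ.injective.ne hi))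
    (I : Set (Fin n)) (J : Set (Fin m)) :
    ρ '' compFace k h I J = compFace (σ k) h (σ '' I) (τ '' J) := by
  have hr : ∀ y x, ρ x = y → (y ∈ ρ '' compFace k h I J ↔ x ∈ compFace k h I J) := by
    rintro _ x rfl
    exact Function.Injective.mem_set_image ρ.injective
  apply set_ext_positions (σ k) h
  · intro i hi
    obtain ⟨i, rfl⟩ := σ.surjective i
    have hi' : i ≠ k := fun e => hi (congrArg _ e)
    rw [hr _ _ (h2 i hi'), outer_mem_compFace, outer_mem_compFace,
      Function.Injective.mem_set_image σ.injective]
  · intro j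
    obtain ⟨j, rfl⟩ := τ.surjective j
    rw [hr _ _ (h1 j), inner_mem_compFace, inner_mem_compFace,
      Function.Injective.mem_set_image σ.injective, Function.Injective.mem_set_image τ.injective]

end faces

section facelaws

variable {l n m P Q N : ℕ}

theorem substFace_parallel {i j : Fin l} (hij : i ≠ j) (hP : P + 1 = l + n)
    (hQ : Q + 1 = l + m) (hPN : N + 1 = P + m) (hQN : N + 1 = Q + n)
    (I : Set (Fin l)) (J : Set (Fin n)) (M : Set (Fin m)) :
    substFace (outerPos i hP j hij.symm) hPN (substFace i hP I J) M =
      substFace (outerPos j hQ i hij) hQN (substFace j hQ I M) J := by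
  apply set_ext_positions (outerPos i hP j hij.symm) hPN
  · intro y hy
    obtain ⟨a, hai, rfl⟩ | ⟨b, rfl⟩ := outer_or_inner i hP y
    · have haj : a ≠ j := fun e => hy (by subst e; rfl)
      rw [outer_mem_substFace, outer_mem_substFace,
        outer_outer hij hai haj hP hQ hPN hQN hy (fun e => hai (outer_injective e)),
        outer_mem_substFace, outer_mem_substFace]
    · rw [outer_mem_substFace, outer_inner hij hP hQ hPN hQN, inner_mem_substFace,
        inner_mem_substFace, outer_mem_substFace]
  · intro c
    rw [← outer_inner hij.symm hQ hP hQN hPN outer_ne_inner.symm, outer_mem_substFace,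
      outer_inner hij.symm hQ hP hQN hPN, inner_mem_substFace, inner_mem_substFace,
      outer_mem_substFace]

theorem compFace_parallel {i j : Fin l} (hij : i ≠ j) (hP : P + 1 = l + n)
    (hQ : Q + 1 = l + m) (hPN : N + 1 = P + m) (hQN : N + 1 = Q + n)
    (I : Set (Fin l)) (J : Set (Fin n)) (M : Set (Fin m)) :
    compFace (outerPos i hP j hij.symm) hPN (compFace i hP I J) M =
      compFace (outerPos j hQ i hij) hQN (compFace j hQ I M) J := by
  apply set_ext_positions (outerPos i hP j hij.symm) hPN
  · intro y hy
    obtain ⟨a, hai, rfl⟩ | ⟨b, rfl⟩ := outer_or_inner i hP y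
    · have haj : a ≠ j := fun e => hy (by subst e; rfl)
      rw [outer_mem_compFace, outer_mem_compFace,
        outer_outer hij hai haj hP hQ hPN hQN hy (fun e => hai (outer_injective e)),
        outer_mem_compFace, outer_mem_compFace]
    · rw [outer_mem_compFace, outer_inner hij hP hQ hPN hQN, inner_mem_compFace,
        inner_mem_compFace, outer_mem_compFace]
  · intro c
    rw [← outer_inner hij.symm hQ hP hQN hPN outer_ne_inner.symm, outer_mem_compFace,
      outer_inner hij.symm hQ hP hQN hPN, inner_mem_compFace, inner_mem_compFace,
      outer_mem_compFace]

theorem substFace_sequential (i : Fin l) (j : Fin n) (hP : P + 1 = l + n)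
    (hQ : Q + 1 = n + m) (hPN : N + 1 = P + m) (hQN : N + 1 = l + Q)
    (I : Set (Fin l)) (J : Set (Fin n)) (M : Set (Fin m)) :
    substFace (innerPos i hP j) hPN (substFace i hP I J) M =
      substFace i hQN I (substFace j hQ J M) := by
  apply set_ext_positions (innerPos i hP j) hPN
  · intro y hy
    obtain ⟨a, hai, rfl⟩ | ⟨b, rfl⟩ := outer_or_inner i hP y
    · rw [outer_mem_substFace, outer_mem_substFace, seq_outer hai hP hQ hPN hQN,
        outer_mem_substFace]
    · have hbj : b ≠ j := fun e => hy (by rw [e])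
      rw [outer_mem_substFace, inner_mem_substFace, seq_inner_outer hbj hP hQ hPN hQN,
        inner_mem_substFace, outer_mem_substFace]
  · intro c
    rw [inner_mem_substFace, inner_mem_substFace, seq_inner_inner hP hQ hPN hQN,
      inner_mem_substFace, inner_mem_substFace, and_assoc]

theorem compFace_sequential (i : Fin l) (j : Fin n) (hP : P + 1 = l + n)
    (hQ : Q + 1 = n + m) (hPN : N + 1 = P + m) (hQN : N + 1 = l + Q)
    (I : Set (Fin l)) (J : Set (Fin n)) (M : Set (Fin m)) :
    compFace (innerPos i hP j) hPN (compFace i hP I J) M =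
      compFace i hQN I (compFace j hQ J M) := by
  apply set_ext_positions (innerPos i hP j) hPN
  · intro y hy
    obtain ⟨a, hai, rfl⟩ | ⟨b, rfl⟩ := outer_or_inner i hP y
    · rw [outer_mem_compFace, outer_mem_compFace, seq_outer hai hP hQ hPN hQN,
        outer_mem_compFace]
    · have hbj : b ≠ j := fun e => hy (by rw [e])
      rw [outer_mem_compFace, inner_mem_compFace, seq_inner_outer hbj hP hQ hPN hQN,
        inner_mem_compFace, outer_mem_compFace]
  · intro c
    rw [inner_mem_compFace, inner_mem_compFace, seq_inner_inner hP hQ hPN hQN,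
      inner_mem_compFace, inner_mem_compFace, or_assoc]

theorem outer_one (k : Fin n) (i : Fin n) (hi : i ≠ k) : outerPos (m := 1) k rfl i hi = i := by
  apply Fin.ext
  simp [outerPos]

theorem inner_one (k : Fin n) (j : Fin 1) : innerPos (N := n) k rfl j = k := by
  apply Fin.ext
  simp [innerPos]

theorem inner_zero_one (h : n + 1 = 1 + n) (j : Fin n) : innerPos 0 h j = j := by
  apply Fin.ext
  simp [innerPos]

theorem self_mem_substFace {k : Fin n} {I : Set (Fin n)} {J : Set (Fin 1)} :
    k ∈ substFace (N := n) k rfl I J ↔ k ∈ I ∧ 0 ∈ J := by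
  have := inner_mem_substFace (N := n) (k := k) (h := rfl) (I := I) (J := J) (j := 0)
  rwa [inner_one] at this

theorem self_mem_compFace {k : Fin n} {I : Set (Fin n)} {J : Set (Fin 1)} :
    k ∈ compFace (N := n) k rfl I J ↔ k ∈ I ∨ 0 ∈ J := by
  have := inner_mem_compFace (N := n) (k := k) (h := rfl) (I := I) (J := J) (j := 0)
  rwa [inner_one] at this

end facelaws

/-- Substitution `K ∘ₖ L` of complexes: the faces are the `I ∘ₖ J` for `I ∈ K`, `J ∈ L`. -/
def SComplex.subst {n m N : ℕ} (k : Fin n) (h : N + 1 = n + m) (K : SComplex n) (L : SComplex m) :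
    SComplex N where
  faces := {X | ∃ I ∈ K.faces, ∃ J ∈ L.faces, substFace k h I J = X}
  down_closed := by
    rintro _ X ⟨I, hI, J, hJ, rfl⟩ hX
    refine ⟨{i | i ∈ I ∧ ∀ hi : i ≠ k, outerPos k h i hi ∈ X},
      K.down_closed hI fun _ hi => hi.1, {j | innerPos k h j ∈ X},
      L.down_closed hJ fun j hj => (inner_mem_substFace.1 (hX hj)).2,
      set_ext_positions k h (fun i hi => ?_) (fun j => ?_)⟩
    · rw [outer_mem_substFace]
      exact ⟨fun hx => hx.2 hi, fun hx => ⟨(outer_mem_substFace hi).1 (hX hx), fun _ => hx⟩⟩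
    · rw [inner_mem_substFace]
      exact ⟨fun hx => hx.2, fun hx =>
        ⟨⟨(inner_mem_substFace.1 (hX hx)).1, fun hk => absurd rfl hk⟩, hx⟩⟩
  nonempty := ⟨_, ∅, K.empty_mem, ∅, L.empty_mem, rfl⟩
  pos := by have := K.pos; have := L.pos; omega

/-- Composition `K ∘ᶜₖ L` of complexes: the downward closure of the family of the `I ∘ᶜₖ J` for
`I ∈ K`, `J ∈ L`. -/
def SComplex.comp {n m N : ℕ} (k : Fin n) (h : N + 1 = n + m) (K : SComplex n) (L : SComplex m) :
    SComplex N where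
  faces := {X | ∃ I ∈ K.faces, ∃ J ∈ L.faces, X ⊆ compFace k h I J}
  down_closed := by
    rintro _ X ⟨I, hI, J, hJ, hY⟩ hX
    exact ⟨I, hI, J, hJ, hX.trans hY⟩
  nonempty := ⟨∅, ∅, K.empty_mem, ∅, L.empty_mem, Set.empty_subset _⟩
  pos := by have := K.pos; have := L.pos; omega

theorem SComplex.act_one {n : ℕ} (K : SComplex n) : K.act 1 = K := by
  ext I
  simp [SComplex.act]

theorem SComplex.act_mul {n : ℕ} (K : SComplex n) (σ τ : Equiv.Perm (Fin n)) :
    K.act (σ * τ) = (K.act σ).act τ := by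
  ext I
  simp [SComplex.act, Set.image_image]

/-- The substitution operad on non-empty simplicial complexes. -/
def substOperad : SetOperad.{0} where
  Op := SComplex
  act := SComplex.act
  one :=
    { faces := {∅, {0}}
      down_closed := by
        rintro I J (rfl | rfl) hJ
        · exact Or.inl (Set.subset_empty_iff.1 hJ)
        · exact Set.subset_singleton_iff_eq.1 hJ
      nonempty := ⟨∅, Or.inl rfl⟩
      pos := one_pos }
  comp := SComplex.subst
  act_one := SComplex.act_one
  act_mul := SComplex.act_mul
  act_comp k h A B σ τ ρ h1 h2 := by
    ext X
    constructor
    · rintro ⟨I, hI, J, hJ, rfl⟩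
      exact ⟨_, hI, _, hJ, (image_substFace h1 h2 I J).symm⟩
    · rintro ⟨I, hI, J, hJ, hX⟩
      have e1 : σ '' (σ.symm '' I) = I := σ.image_symm_image I
      have e2 : τ '' (τ.symm '' J) = J := τ.image_symm_image J
      refine ⟨σ.symm '' I, by simpa [SComplex.act, e1] using hI, τ.symm '' J,
        by simpa [SComplex.act, e2] using hJ, ?_⟩
      apply ρ.injective.image_injective
      rw [image_substFace h1 h2, e1, e2, hX]
  one_comp h A := by
    ext X
    constructor
    · rintro ⟨I, hI, J, hJ, rfl⟩
      refine A.down_closed hJ fun x hx => ?_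
      rw [← inner_zero_one h x, inner_mem_substFace] at hx
      exact hx.2
    · intro hX
      refine ⟨{0}, Or.inr rfl, X, hX, set_ext_positions 0 h
        (fun i hi => absurd (Subsingleton.elim _ _) hi) fun j => ?_⟩
      rw [inner_mem_substFace, inner_zero_one]
      simp
  comp_one k A := by
    ext X
    constructor
    · rintro ⟨I, hI, J, hJ, rfl⟩
      refine A.down_closed hI fun x hx => ?_
      by_cases hk : x = k
      · subst hk
        rw [self_mem_substFace] at hx
        exact hx.1
      · rw [← outer_one k x hk, outer_mem_substFace] at hx
        exact hx
    · intro hX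
      refine ⟨X, hX, {0}, Or.inr rfl, set_ext_positions k rfl (fun i hi => ?_) fun j => ?_⟩
      · rw [outer_mem_substFace, outer_one]
      · rw [inner_mem_substFace, inner_one]
        simp [Subsingleton.elim j 0]
  parallel i j hij hP hQ hPN hQN A B C := by
    ext X
    constructor
    · rintro ⟨_, ⟨I, hI, J, hJ, rfl⟩, M, hM, rfl⟩
      exact ⟨_, ⟨I, hI, M, hM, rfl⟩, J, hJ, (substFace_parallel hij hP hQ hPN hQN I J M).symm⟩
    · rintro ⟨_, ⟨I, hI, M, hM, rfl⟩, J, hJ, rfl⟩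
      exact ⟨_, ⟨I, hI, J, hJ, rfl⟩, M, hM, substFace_parallel hij hP hQ hPN hQN I J M⟩
  sequential i j hP hQ hPN hQN A B C := by
    ext X
    constructor
    · rintro ⟨_, ⟨I, hI, J, hJ, rfl⟩, M, hM, rfl⟩
      exact ⟨I, hI, _, ⟨J, hJ, M, hM, rfl⟩,
        (substFace_sequential i j hP hQ hPN hQN I J M).symm⟩
    · rintro ⟨I, hI, _, ⟨J, hJ, M, hM, rfl⟩, rfl⟩
      exact ⟨_, ⟨I, hI, J, hJ, rfl⟩, M, hM, substFace_sequential i j hP hQ hPN hQN I J M⟩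

/-- The composition operad on non-empty simplicial complexes. -/
def compOperad : SetOperad.{0} where
  Op := SComplex
  act := SComplex.act
  one :=
    { faces := {∅}
      down_closed := by
        rintro I J rfl hJ
        exact Set.subset_empty_iff.1 hJ
      nonempty := ⟨∅, rfl⟩
      pos := one_pos }
  comp := SComplex.comp
  act_one := SComplex.act_one
  act_mul := SComplex.act_mul
  act_comp k h A B σ τ ρ h1 h2 := by
    ext X
    constructor
    · rintro ⟨I, hI, J, hJ, hX⟩
      exact ⟨_, hI, _, hJ, (Set.image_mono hX).trans (image_compFace h1 h2 I J).subset⟩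
    · rintro ⟨I, hI, J, hJ, hX⟩
      have e1 : σ '' (σ.symm '' I) = I := σ.image_symm_image I
      have e2 : τ '' (τ.symm '' J) = J := τ.image_symm_image J
      refine ⟨σ.symm '' I, by simpa [SComplex.act, e1] using hI, τ.symm '' J,
        by simpa [SComplex.act, e2] using hJ, ?_⟩
      rw [← Set.image_subset_image_iff ρ.injective, image_compFace h1 h2, e1, e2]
      exact hX
  one_comp h A := by
    ext X
    constructor
    · rintro ⟨I, rfl, J, hJ, hX⟩
      refine A.down_closed hJ fun x hx => ?_
      have := hX hx
      rw [← inner_zero_one h x, inner_mem_compFace] at this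
      exact this.resolve_left (by simp)
    · intro hX
      refine ⟨∅, rfl, X, hX, fun x hx => ?_⟩
      rw [← inner_zero_one h x, inner_mem_compFace]
      exact Or.inr hx
  comp_one k A := by
    ext X
    constructor
    · rintro ⟨I, hI, J, rfl, hX⟩
      refine A.down_closed hI fun x hx => ?_
      have := hX hx
      by_cases hk : x = k
      · subst hk
        rw [self_mem_compFace] at this
        exact this.resolve_right (by simp)
      · rw [← outer_one k x hk, outer_mem_compFace] at this
        exact this
    · intro hX
      refine ⟨X, hX, ∅, rfl, fun x hx => ?_⟩
      by_cases hk : x = k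
      · subst hk
        rw [self_mem_compFace]
        exact Or.inl hx
      · rw [← outer_one k x hk, outer_mem_compFace]
        exact hx
  parallel i j hij hP hQ hPN hQN A B C := by
    ext X
    constructor
    · rintro ⟨Y, ⟨I, hI, J, hJ, hY⟩, M, hM, hX⟩
      refine ⟨_, ⟨I, hI, M, hM, subset_rfl⟩, J, hJ, ?_⟩
      rw [← compFace_parallel hij hP hQ hPN hQN I J M]
      exact hX.trans (compFace_mono hY subset_rfl)
    · rintro ⟨Y, ⟨I, hI, M, hM, hY⟩, J, hJ, hX⟩
      refine ⟨_, ⟨I, hI, J, hJ, subset_rfl⟩, M, hM, ?_⟩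
      rw [compFace_parallel hij hP hQ hPN hQN I J M]
      exact hX.trans (compFace_mono hY subset_rfl)
  sequential i j hP hQ hPN hQN A B C := by
    ext X
    constructor
    · rintro ⟨Y, ⟨I, hI, J, hJ, hY⟩, M, hM, hX⟩
      refine ⟨I, hI, _, ⟨J, hJ, M, hM, subset_rfl⟩, ?_⟩
      rw [← compFace_sequential i j hP hQ hPN hQN I J M]
      exact hX.trans (compFace_mono hY subset_rfl)
    · rintro ⟨I, hI, Y, ⟨J, hJ, M, hM, hY⟩, hX⟩
      refine ⟨_, ⟨I, hI, J, hJ, subset_rfl⟩, M, hM, ?_⟩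
      rw [compFace_sequential i j hP hQ hPN hQN I J M]
      exact hX.trans (compFace_mono subset_rfl hY)

/-! ### The cubical functor and the polyhedral limits -/

section category

attribute [local instance] CategoryStruct.toQuiver

variable {C : Type u} [Category.{v} C]

/-- The functor `{0 → 1} ⥤ C` given by an arrow `f : Y ⟶ X`, composed with the monotone map
sending a subset `I` to `1` if `i ∈ I` and to `0` otherwise.  So it sends `I` to `X` if `i ∈ I` and
to `Y` if `i ∉ I`, and an inclusion `I ⊆ J` to `f` if `i ∈ J \ I` and to an identity otherwise. -/
noncomputable def cubeFactor {n : ℕ} (f : Arrow C) (i : Fin n) : Set (Fin n) ⥤ C :=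
  open Classical in
  Monotone.functor (f := fun I : Set (Fin n) => if i ∈ I then (1 : Fin 2) else 0)
    (fun I J hIJ => by
      by_cases hI : i ∈ I
      · simp [hI, hIJ hI]
      · simp [hI]) ⋙ ComposableArrows.mk₁ f.hom

variable [MonoidalCategory C]

/-- The tensor product `X₀ ⊗ (X₁ ⊗ (⋯ ⊗ 𝟙))` of a finite sequence of objects. -/
def tensorObjs : ∀ {n : ℕ}, (Fin n → C) → C
  | 0, _ => 𝟙_ C
  | _ + 1, X => X 0 ⊗ tensorObjs fun i => X i.succ

/-- The tensor product of a finite sequence of morphisms. -/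
def tensorHoms : ∀ {n : ℕ} {X Y : Fin n → C}, (∀ i, X i ⟶ Y i) → (tensorObjs X ⟶ tensorObjs Y)
  | 0, _, _, _ => 𝟙 (𝟙_ C)
  | _ + 1, _, _, φ => φ 0 ⊗ₘ tensorHoms fun i => φ i.succ

theorem tensorHoms_id : ∀ {n : ℕ} (X : Fin n → C),
    tensorHoms (fun i => 𝟙 (X i)) = 𝟙 (tensorObjs X)
  | 0, _ => rfl
  | _ + 1, X =>
    (congrArg (fun t => 𝟙 (X 0) ⊗ₘ t) (tensorHoms_id fun i => X i.succ)).trans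
      (id_tensorHom_id _ _)

theorem tensorHoms_comp : ∀ {n : ℕ} {X Y Z : Fin n → C} (φ : ∀ i, X i ⟶ Y i)
    (ψ : ∀ i, Y i ⟶ Z i),
    tensorHoms (fun i => φ i ≫ ψ i) = tensorHoms φ ≫ tensorHoms ψ
  | 0, _, _, _, _, _ => (Category.id_comp _).symm
  | _ + 1, _, _, _, φ, ψ =>
    (congrArg (fun t => (φ 0 ≫ ψ 0) ⊗ₘ t)
      (tensorHoms_comp (fun i => φ i.succ) (fun i => ψ i.succ))).trans
      (tensorHom_comp_tensorHom _ _ _ _).symm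

/-- The cubical functor `(℘([n]), ⊆) ⥤ C` of a sequence of arrows `fᵢ : Yᵢ ⟶ Xᵢ`: a subset `I` is
sent to the tensor product of the `Xᵢ` for `i ∈ I` and the `Yᵢ` for `i ∉ I`, in order. -/
noncomputable def cube {n : ℕ} (f : Fin n → Arrow C) : Set (Fin n) ⥤ C where
  obj I := tensorObjs fun i => (cubeFactor (f i) i).obj I
  map g := tensorHoms fun i => (cubeFactor (f i) i).map g
  map_id I :=
    (congrArg tensorHoms (funext fun i => (cubeFactor (f i) i).map_id I)).trans (tensorHoms_id _)
  map_comp g g' :=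
    (congrArg tensorHoms (funext fun i => (cubeFactor (f i) i).map_comp g g')).trans
      (tensorHoms_comp _ _)

/-- The face category of a non-empty complex: the poset of its faces (the empty one included). -/
abbrev SComplex.Face {n : ℕ} (K : SComplex n) : Type := {I : Set (Fin n) // I ∈ K.faces}

/-- The opposite face category of `K`, identified through complementation with the poset of the
complements of the faces of `K`. -/
def SComplex.coface {n : ℕ} (K : SComplex n) : K.Faceᵒᵖ ⥤ Set (Fin n) where
  obj I := I.unop.1ᶜ
  map g := homOfLE (Set.compl_subset_compl.2 (leOfHom g.unop))

/-- The cubical functor on the opposite face category of `K`, `I ↦ z([n] \ I; f)`: its value at a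
face `I` is the tensor product of the `Yᵢ` for `i ∈ I` and the `Xᵢ` for `i ∉ I`. -/
noncomputable def coCube {n : ℕ} (K : SComplex n) (f : Fin n → Arrow C) : K.Faceᵒᵖ ⥤ C :=
  K.coface ⋙ cube f

noncomputable instance {n : ℕ} (K : SComplex n) : Fintype K.Face := Fintype.ofFinite _

instance hasLimitsOfShape_face [HasFiniteLimits C] {n : ℕ} (K : SComplex n) :
    HasLimitsOfShape K.Faceᵒᵖ C := inferInstance

variable [HasFiniteLimits C]

/-- The canonical arrow `lim_{I ∈ cat(K)ᵒᵖ} z([n] \ I; f) ⟶ z([n]; f)`: the projection to the value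
at the empty face. -/
noncomputable def polyLimit {n : ℕ} (K : SComplex n) (f : Fin n → Arrow C) : Arrow C :=
  Arrow.mk (limit.π (coCube K f) (op ⟨∅, K.empty_mem⟩) ≫
    (cube f).map (homOfLE (Set.subset_univ _) : (∅ : Set (Fin n))ᶜ ⟶ Set.univ))

/-- The canonical arrow `z(∅; f) ⟶ lim_{I ∈ cat(K)ᵒᵖ} z([n] \ I; f)`, whose components are the
`z(∅ ⊆ [n] \ I; f)`. -/
noncomputable def polyLimitComp {n : ℕ} (K : SComplex n) (f : Fin n → Arrow C) : Arrow C :=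
  Arrow.mk (limit.lift (coCube K f)
    { pt := (cube f).obj ∅
      π :=
        { app := fun I => (cube f).map (homOfLE (Set.empty_subset _))
          naturality := fun I J g => by
            exact (Category.id_comp _).trans ((cube f).map_comp
              (homOfLE (Set.empty_subset _) : ∅ ⟶ K.coface.obj I) (K.coface.map g)) } })

end category

/-- The set of isomorphism classes of arrows of `C` (isomorphisms being commutative squares whose
horizontal sides are invertible). -/
abbrev ArrowClass (C : Type u) [Category.{v} C] : Type (max u v) :=
  Quotient (isIsomorphicSetoid (Arrow C))

/-- The isomorphism class of an arrow. -/
def arrowClass {C : Type u} [Category.{v} C] (f : Arrow C) : ArrowClass C :=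
  Quotient.mk (isIsomorphicSetoid (Arrow C)) f

/-- Strict monoidal categories: associators and unitors are identities. -/
structure IsStrict (C : Type u) [Category.{v} C] [MonoidalCategory C] : Prop where
  assoc_eq : ∀ X Y Z : C, (X ⊗ Y) ⊗ Z = X ⊗ (Y ⊗ Z)
  associator_eq : ∀ X Y Z : C, α_ X Y Z = eqToIso (assoc_eq X Y Z)
  unit_tensor : ∀ X : C, 𝟙_ C ⊗ X = X
  leftUnitor_eq : ∀ X : C, λ_ X = eqToIso (unit_tensor X)
  tensor_unit : ∀ X : C, X ⊗ 𝟙_ C = X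
  rightUnitor_eq : ∀ X : C, ρ_ X = eqToIso (tensor_unit X)

/-- Two arrows have the same codomain, and are isomorphic over it. -/
def SameOver {C : Type u} [Category.{v} C] (f g : Arrow C) : Prop :=
  ∃ (h : f.right = g.right) (e : f.left ≅ g.left), f.hom ≫ eqToHom h = e.hom ≫ g.hom

/-- Two arrows have the same domain, and are isomorphic under it. -/
def SameUnder {C : Type u} [Category.{v} C] (f g : Arrow C) : Prop :=
  ∃ (h : f.left = g.left) (e : f.right ≅ g.right), f.hom ≫ e.hom = eqToHom h ≫ g.hom

end PolyLim

open PolyLim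

/-!
Both composition laws come from one computation. Let `g` be the sequence of arrows obtained from `f`
by replacing a block with the single arrow `F` given by the polyhedral limit of `L` on that block.
A vertex `A` of the cube on `g` is a tensor product whose factor at the position `k` is one of the
ends of `F`. One end is a limit over the faces `J` of `L` of vertices of the cube on the block, the
other end is a single vertex, hence the limit of a constant diagram over the face category, which is
connected. Since the tensor product preserves finite limits in each variable, the vertex `A` is the
limit over `J` of vertices `T (A, J)` of the cube on `f` (`nonempty_isLimit_graftMap`). Complements
exchange the two rules for composing faces: the complement of `I ∘ₖ J` is `Iᶜ ∘ᶜₖ Jᶜ`, and the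
complement of `I ∘ᶜₖ J` is `Iᶜ ∘ₖ Jᶜ`; so `T (Iᶜ, J)` is the vertex that belongs to the composed face
of `I` and `J`. The iterated limit over `I` and `J` is a limit over pairs of faces, and the functor
from pairs of faces to faces of the composed complex is initial on opposite categories; therefore it
is the limit defining the polyhedral limit of the composed complex (`exists_limit_iso`,
`exists_limit_coCube_iso`, and the `Initial` instances for `substFaces` and `compFaces`).

The isomorphism of codomains (for substitution) or of domains (for composition) that comes along only
rearranges parentheses. Morphisms of this kind are tracked by the predicate `Coh`: they are
isomorphisms in general, and identities if `C` is strict, which is why the isomorphisms of arrows are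
then over, or under, a common object.

Equivariance needs the symmetry, and only up to isomorphism: permutations act on tensor products
because adjacent transpositions do (`reorders`). Equivariance for the identity permutation gives
independence of representatives (`arrowClass_polyLimit_congr`). For the two unit complexes, the face
category has a largest element, at which the limit is evaluated (`cohOver_one`, `cohUnder_one`).
-/

namespace PolyLim

/-! ### Coherence morphisms -/

section coherence

variable {C : Type u} [Category.{v} C] [MonoidalCategory C]

/-- A morphism that a monoidal coherence diagram would supply: it is invertible, and an identity,
up to an equality of objects, as soon as `C` is strict. The second half is what turns an
isomorphism of arrows into one over (or under) a common object in the strict case. -/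
def Coh {X Y : C} (φ : X ⟶ Y) : Prop :=
  IsIso φ ∧ (IsStrict C → ∃ e : X = Y, φ = eqToHom e)

theorem Coh.eqToHom {X Y : C} (e : X = Y) : Coh (eqToHom e) :=
  ⟨inferInstance, fun _ => ⟨e, rfl⟩⟩

theorem Coh.comp {X Y Z : C} {φ : X ⟶ Y} {ψ : Y ⟶ Z} (hφ : Coh φ) (hψ : Coh ψ) :
    Coh (φ ≫ ψ) := by
  have := hφ.1
  have := hψ.1
  refine ⟨inferInstance, fun hC => ?_⟩
  obtain ⟨e, rfl⟩ := hφ.2 hC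
  obtain ⟨e', rfl⟩ := hψ.2 hC
  exact ⟨e.trans e', eqToHom_trans _ _⟩

theorem Coh.tensor {X Y X' Y' : C} {φ : X ⟶ Y} {ψ : X' ⟶ Y'} (hφ : Coh φ) (hψ : Coh ψ) :
    Coh (φ ⊗ₘ ψ) := by
  have := hφ.1
  have := hψ.1
  refine ⟨inferInstance, fun hC => ?_⟩
  obtain ⟨e, rfl⟩ := hφ.2 hC
  obtain ⟨e', rfl⟩ := hψ.2 hC
  subst e e'
  exact ⟨rfl, id_tensorHom_id _ _⟩

theorem Coh.associator (X Y Z : C) : Coh (α_ X Y Z).hom :=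
  ⟨inferInstance, fun hC => ⟨hC.assoc_eq X Y Z, by rw [hC.associator_eq, eqToIso.hom]⟩⟩

theorem Coh.leftUnitor (X : C) : Coh (λ_ X).hom :=
  ⟨inferInstance, fun hC => ⟨hC.unit_tensor X, by rw [hC.leftUnitor_eq, eqToIso.hom]⟩⟩

theorem Coh.rightUnitor_inv (X : C) : Coh (ρ_ X).inv :=
  ⟨inferInstance, fun hC => ⟨(hC.tensor_unit X).symm, by rw [hC.rightUnitor_eq, eqToIso.inv]⟩⟩

theorem Coh.tensorHoms : ∀ {n : ℕ} {X Y : Fin n → C} {φ : ∀ i, X i ⟶ Y i} (_ : ∀ i, Coh (φ i)),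
    Coh (tensorHoms φ)
  | 0, _, _, _, _ => Coh.eqToHom (C := C) (X := 𝟙_ C) rfl
  | _ + 1, _, _, _, h => (h 0).tensor (Coh.tensorHoms fun i => h i.succ)

theorem isIso_tensorHoms : ∀ {n : ℕ} {X Y : Fin n → C} (φ : ∀ i, X i ⟶ Y i)
    (_ : ∀ i, IsIso (φ i)), IsIso (tensorHoms φ)
  | 0, _, _, _, _ => inferInstanceAs (IsIso (𝟙 (𝟙_ C)))
  | _ + 1, _, _, φ, h => by
    have := h 0
    have := isIso_tensorHoms (fun i => φ i.succ) fun i => h i.succ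
    exact inferInstanceAs (IsIso (φ 0 ⊗ₘ PolyLim.tensorHoms fun i => φ i.succ))

/-- In a poset, an arrow between elements that are `≤` each other is an identity. -/
theorem Coh.map_of_le_of_le {P : Type w} [PartialOrder P] (G : P ⥤ C) {a b : P} (g : a ⟶ b)
    (h : b ≤ a) : Coh (G.map g) := by
  obtain rfl := le_antisymm (leOfHom g) h
  rw [Subsingleton.elim g (𝟙 a), G.map_id]
  exact Coh.eqToHom rfl

end coherence

/-! ### Iterated limits and initial functors -/

section limits

universe u₁ v₁ u₂ v₂ u₃ v₃

variable {C : Type u} [Category.{v} C]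

/-- Transport of a limit cone along isomorphisms of the diagram and of the cone point. -/
def isLimitOfIso {Q : Type u₁} [Category.{v₁} Q] {F G : Q ⥤ C} {c : Cone F} (hc : IsLimit c)
    {c' : Cone G} (e : c'.pt ≅ c.pt) (φ : F ≅ G)
    (h : ∀ q, e.hom ≫ c.π.app q ≫ φ.hom.app q = c'.π.app q) : IsLimit c' :=
  IsLimit.ofIsoLimit ((IsLimit.postcomposeHomEquiv φ c).symm hc)
    (Cone.ext e.symm fun q => by simp [← h q])

theorem nonempty_isLimit_of_isIso_legs {Q : Type u₁} [Category.{v₁} Q] [IsConnected Q]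
    {F : Q ⥤ C} (c : Cone F) (h : ∀ q, IsIso (c.π.app q)) : Nonempty (IsLimit c) := by
  obtain ⟨q₀⟩ : Nonempty Q := inferInstance
  refine ⟨{ lift := fun s => s.π.app q₀ ≫ inv (c.π.app q₀), fac := fun s q => ?_,
            uniq := fun s m hm => ?_ }⟩
  · have key : s.π.app q₀ ≫ inv (c.π.app q₀) = s.π.app q ≫ inv (c.π.app q) := by
      refine constant_of_preserves_morphisms (fun q => s.π.app q ≫ inv (c.π.app q)) ?_ q₀ q
      intro q q' g
      have := h q
      have := h q'
      simp only [IsIso.eq_comp_inv, Category.assoc]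
      rw [← c.w g, IsIso.inv_hom_id_assoc, s.w g]
    rw [key]
    simp
  · rw [IsIso.eq_comp_inv, hm]

/-- A criterion for a functor to a poset to be initial: each comma category is connected, because
any of its objects `p` is joined to a chosen one `p₀` by a zigzag `p ⟶ p₁ ⟵ p₂ ⟶ p₀`. -/
theorem initial_of_thin {P : Type u₁} [Category.{v₁} P] {R : Type u₂} [Category.{v₂} R]
    [Quiver.IsThin R] (S : P ⥤ R)
    (H : ∀ r, ∃ p₀, Nonempty (S.obj p₀ ⟶ r) ∧ ∀ p, Nonempty (S.obj p ⟶ r) →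
      ∃ p₁ p₂, Nonempty (S.obj p₁ ⟶ r) ∧ Nonempty (p ⟶ p₁) ∧ Nonempty (p₂ ⟶ p₁) ∧
        Nonempty (p₂ ⟶ p₀)) : S.Initial := by
  refine ⟨fun r => ?_⟩
  obtain ⟨p₀, ⟨g₀⟩, H⟩ := H r
  have : Nonempty (CostructuredArrow S r) := ⟨CostructuredArrow.mk g₀⟩
  have key : ∀ x : CostructuredArrow S r, Zigzag x (CostructuredArrow.mk g₀) := by
    intro x
    obtain ⟨p₁, p₂, ⟨g₁⟩, ⟨a⟩, ⟨b⟩, ⟨c⟩⟩ := H x.left ⟨x.hom⟩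
    have z₁ : Zag x (CostructuredArrow.mk g₁) :=
      Or.inl ⟨CostructuredArrow.homMk a (Subsingleton.elim _ _)⟩
    have z₂ : Zag (CostructuredArrow.mk (S.map b ≫ g₁)) (CostructuredArrow.mk g₁) :=
      Or.inl ⟨CostructuredArrow.homMk b rfl⟩
    have z₃ : Zag (CostructuredArrow.mk (S.map b ≫ g₁)) (CostructuredArrow.mk g₀) :=
      Or.inl ⟨CostructuredArrow.homMk c (Subsingleton.elim _ _)⟩
    exact (Zigzag.of_zag z₁).trans ((Zigzag.of_zag z₂).symm.trans (Zigzag.of_zag z₃))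
  exact zigzag_isConnected fun x y => (key x).trans (key y).symm

/-- The cone, over the restriction of `S ⋙ E` to `{p} × Q`, given by a compatible family `φ`. -/
def partialCone {P : Type u₁} [Category.{v₁} P] {Q : Type u₂} [Category.{v₂} Q] {R : Type u₃}
    [Category.{v₃} R] (E : R ⥤ C) (S : P × Q ⥤ R) (p : P) {X : C}
    (φ : ∀ q, X ⟶ E.obj (S.obj (p, q)))
    (nat : ∀ {q q'} (g : q ⟶ q'), φ q ≫ E.map (S.map (Prod.mkHom (𝟙 p) g)) = φ q') :
    Cone (Prod.sectR p Q ⋙ S ⋙ E) where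
  pt := X
  π := { app := φ, naturality := fun _ _ g => (Category.id_comp _).trans (nat g).symm }

/-- Fubini for limits along an initial functor: if `G p` is the limit over `q` of `E (S (p, q))`,
naturally in `p`, and `S` is initial, then `E` and `G` have the same limit. -/
theorem exists_limit_iso {P : Type u₁} [Category.{v₁} P] {Q : Type u₂} [Category.{v₂} Q]
    {R : Type u₃} [Category.{v₃} R] (E : R ⥤ C) (G : P ⥤ C) (S : P × Q ⥤ R) [S.Initial]
    [HasLimit E] [HasLimit G] (φ : ∀ p q, G.obj p ⟶ E.obj (S.obj (p, q)))
    (nat : ∀ {p p'} (f : p ⟶ p') {q q'} (g : q ⟶ q'),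
      φ p q ≫ E.map (S.map (Prod.mkHom f g)) = G.map f ≫ φ p' q')
    (hlim : ∀ p, Nonempty (IsLimit (partialCone E S p (φ p)
      fun g => by rw [nat, G.map_id, Category.id_comp]))) :
    ∃ e : limit E ≅ limit G,
      ∀ p q, e.hom ≫ limit.π G p ≫ φ p q = limit.π E (S.obj (p, q)) := by
  have ext : ∀ p {T : C} (a b : T ⟶ G.obj p), (∀ q, a ≫ φ p q = b ≫ φ p q) → a = b :=
    fun p _ _ _ h => (hlim p).some.hom_ext h
  have lift : ∀ p (s : Cone (S ⋙ E)), ∃ l : s.pt ⟶ G.obj p,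
      ∀ q, l ≫ φ p q = s.π.app (p, q) := fun p s =>
    ⟨(hlim p).some.lift (partialCone E S p (fun q => s.π.app (p, q))
      fun g => s.w (Prod.mkHom (𝟙 p) g)), fun q => (hlim p).some.fac _ q⟩
  choose l hl using lift
  let cG : Cone (S ⋙ E) :=
    { pt := limit G
      π :=
        { app := fun x => limit.π G x.1 ≫ φ x.1 x.2
          naturality := fun x y g => by
            have := nat g.1 g.2
            dsimp at this ⊢
            rw [Category.id_comp, Category.assoc, show g = Prod.mkHom g.1 g.2 from rfl, this,
              limit.w_assoc] } }
  have hcG : IsLimit cG := by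
    refine
      { lift := fun s => limit.lift G
          { pt := s.pt
            π :=
              { app := fun p => l p s
                naturality := fun p p' f => ext p' _ _ fun q => ?_ } }
        fac := fun s x => ?_
        uniq := fun s m hm => limit.hom_ext fun p => ext p _ _ fun q => ?_ }
    · change (𝟙 s.pt ≫ l p' s) ≫ φ p' q = (l p s ≫ G.map f) ≫ φ p' q
      rw [Category.id_comp, hl, Category.assoc, ← nat f (𝟙 q), ← Category.assoc, hl]
      exact (s.w (Prod.mkHom f (𝟙 q))).symm
    · dsimp [cG]
      rw [limit.lift_π_assoc]
      exact hl x.1 s x.2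
    · rw [limit.lift_π, Category.assoc]
      exact (hm (p, q)).trans (hl p s q).symm
  refine ⟨(Functor.Initial.limitIso S E).symm ≪≫ (limit.isLimit (S ⋙ E)).conePointUniqueUpToIso hcG,
    fun p q => ?_⟩
  have h1 := (limit.isLimit (S ⋙ E)).conePointUniqueUpToIso_hom_comp hcG (p, q)
  dsimp [cG] at h1
  rw [Iso.trans_hom, Category.assoc, h1]
  simp [Functor.Initial.limitIso]

end limits

/-! ### Inserting a tensor product into a tensor product -/

section assembly

-- As for the definition of `cube`: gives the quiver structure of the category precedence over the
-- one that instance search finds on `C` by way of reflexive quivers.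
attribute [local instance] CategoryStruct.toQuiver

variable {C : Type u} [Category.{v} C]

/-- The identification of the entries of a sequence at two equal positions. -/
def castPos {N : ℕ} (W : Fin N → C) {x y : Fin N} (e : x = y) : W x ⟶ W y :=
  eqToHom (congrArg W e)

theorem castPos_naturality {N : ℕ} {W W' : Fin N → C} (w : ∀ x, W x ⟶ W' x) {x y : Fin N}
    (e : x = y) : castPos W e ≫ w y = w x ≫ castPos W' e := by
  subst e
  simp [castPos]

/-- Away from the first position, insertion at `k + 1` is the shift of insertion at `k` into the
tail; this and the next lemmas are the bookkeeping for recursions on the position of insertion. -/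
theorem tail_outerPos {n m N : ℕ} {k : ℕ} (hk : k + 1 < n + 1) (h : N + 1 + 1 = n + 1 + m)
    (i : Fin n) (hi : i ≠ ⟨k, Nat.lt_of_succ_lt_succ hk⟩) :
    outerPos ⟨k + 1, hk⟩ h i.succ (fun e => hi (Fin.succ_injective _ e)) =
      (outerPos ⟨k, Nat.lt_of_succ_lt_succ hk⟩ (by omega : N + 1 = n + m) i hi).succ := by
  have := Fin.val_ne_of_ne hi
  apply Fin.ext
  simp only [outerPos, Fin.lt_def, Fin.val_succ] at this ⊢
  split_ifs <;> omega

theorem tail_innerPos {n m N : ℕ} {k : ℕ} (hk : k + 1 < n + 1) (h : N + 1 + 1 = n + 1 + m)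
    (j : Fin m) : innerPos ⟨k + 1, hk⟩ h j =
      (innerPos ⟨k, Nat.lt_of_succ_lt_succ hk⟩ (by omega : N + 1 = n + m) j).succ := by
  apply Fin.ext
  simp only [innerPos, Fin.val_succ]
  omega

theorem head_outerPos {n m N : ℕ} {k : ℕ} (hk : k + 1 < n + 1) (h : N + 1 + 1 = n + 1 + m) :
    outerPos ⟨k + 1, hk⟩ h 0 (fun e => by simpa using congrArg Fin.val e) = 0 := by
  apply Fin.ext
  simp [outerPos, Fin.lt_def]

theorem head_zero_innerPos {n m N : ℕ} (h : N + 1 = n + 1 + m) (j : Fin m) :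
    innerPos ⟨0, n.succ_pos⟩ h j = ⟨j, by omega⟩ := by
  apply Fin.ext
  simp [innerPos]

theorem tail_zero_outerPos {n m N : ℕ} (h : N + 1 = n + 1 + m) (i : Fin n) :
    outerPos ⟨0, n.succ_pos⟩ h i.succ (fun e => by simpa using congrArg Fin.val e) =
      ⟨i + m, by omega⟩ := by
  apply Fin.ext
  simp only [outerPos, Fin.lt_def, Fin.val_succ]
  split_ifs <;> omega

variable [MonoidalCategory C]

theorem tensor_square {X Y Z T X' Y' Z' T' : C} {p : X ⟶ Y} {r : Y ⟶ Z} {p' : X ⟶ T} {r' : T ⟶ Z}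
    {q : X' ⟶ Y'} {s : Y' ⟶ Z'} {q' : X' ⟶ T'} {s' : T' ⟶ Z'} (h₁ : p ≫ r = p' ≫ r')
    (h₂ : q ≫ s = q' ≫ s') : (p ⊗ₘ q) ≫ (r ⊗ₘ s) = (p' ⊗ₘ q') ≫ (r' ⊗ₘ s') := by
  rw [tensorHom_comp_tensorHom, tensorHom_comp_tensorHom, h₁, h₂]

theorem associator_square {X Y Z A R X' Y' Z' A' R' : C} {b : X ⟶ A} {p : Y ⊗ Z ⟶ R}
    {b' : X' ⟶ A'} {p' : Y' ⊗ Z' ⟶ R'} {x : X ⟶ X'} {y : Y ⟶ Y'} {z : Z ⟶ Z'} {a : A ⟶ A'}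
    {r : R ⟶ R'} (h₁ : b ≫ a = x ≫ b') (h₂ : p ≫ r = (y ⊗ₘ z) ≫ p') :
    ((α_ X Y Z).hom ≫ (b ⊗ₘ p)) ≫ (a ⊗ₘ r) =
      ((x ⊗ₘ y) ⊗ₘ z) ≫ (α_ X' Y' Z').hom ≫ (b' ⊗ₘ p') := by
  rw [Category.assoc, tensorHom_comp_tensorHom, h₁, h₂, associator_naturality_assoc,
    tensorHom_comp_tensorHom]

theorem whisker_square {X Y Z R X' Y' Z' R' : C} {a : X ⟶ Y} {p : Y ⊗ Z ⟶ R} {a' : X' ⟶ Y'}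
    {p' : Y' ⊗ Z' ⟶ R'} {x : X ⟶ X'} {y : Y ⟶ Y'} {z : Z ⟶ Z'} {r : R ⟶ R'}
    (h₁ : a ≫ y = x ≫ a') (h₂ : p ≫ r = (y ⊗ₘ z) ≫ p') :
    ((a ⊗ₘ 𝟙 Z) ≫ p) ≫ r = (x ⊗ₘ z) ≫ (a' ⊗ₘ 𝟙 Z') ≫ p' := by
  rw [Category.assoc, h₂, tensorHom_comp_tensorHom_assoc, tensorHom_comp_tensorHom_assoc, h₁,
    Category.id_comp, Category.comp_id]

theorem Coh.castPos {N : ℕ} (W : Fin N → C) {x y : Fin N} (e : x = y) : Coh (castPos W e) :=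
  Coh.eqToHom _

/-- The comparison of `(U₀ ⊗ ⋯) ⊗ (V₀ ⊗ ⋯)` with the tensor product of a concatenated sequence `W`,
whose entries receive those of `U` and `V` by the morphisms `b` and `c`. -/
def appendHom : ∀ {m n N : ℕ} (_ : N = n + m) {U : Fin m → C} {V : Fin n → C} {W : Fin N → C}
    (_ : ∀ j : Fin m, U j ⟶ W ⟨j, by omega⟩) (_ : ∀ i : Fin n, V i ⟶ W ⟨i + m, by omega⟩),
    tensorObjs U ⊗ tensorObjs V ⟶ tensorObjs W
  | 0, _, _, rfl, _, _, _, _, c => (λ_ _).hom ≫ tensorHoms c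
  | _ + 1, _, _, rfl, _, _, W, b, c =>
    (α_ _ _ _).hom ≫ (b 0 ⊗ₘ appendHom (W := fun x => W x.succ) rfl (fun j => b j.succ) c)

theorem appendHom_naturality : ∀ {m n N : ℕ} (h : N = n + m) {U U' : Fin m → C}
    {V V' : Fin n → C} {W W' : Fin N → C}
    {b : ∀ j : Fin m, U j ⟶ W ⟨j, by omega⟩} {c : ∀ i : Fin n, V i ⟶ W ⟨i + m, by omega⟩}
    {b' : ∀ j : Fin m, U' j ⟶ W' ⟨j, by omega⟩} {c' : ∀ i : Fin n, V' i ⟶ W' ⟨i + m, by omega⟩}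
    {u : ∀ j, U j ⟶ U' j} {v : ∀ i, V i ⟶ V' i} {w : ∀ x, W x ⟶ W' x}
    (_ : ∀ j, b j ≫ w _ = u j ≫ b' j) (_ : ∀ i, c i ≫ w _ = v i ≫ c' i),
    appendHom h b c ≫ tensorHoms w = (tensorHoms u ⊗ₘ tensorHoms v) ≫ appendHom h b' c'
  | 0, _, _, rfl, U, U', V, V', W, W', b, c, b', c', u, v, w, _, hc => by
    change ((λ_ _).hom ≫ tensorHoms c) ≫ tensorHoms w =
      (𝟙 (𝟙_ C) ⊗ₘ tensorHoms v) ≫ (λ_ _).hom ≫ tensorHoms c'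
    rw [Category.assoc, ← tensorHoms_comp, show (fun i => c i ≫ w i) = _ from funext hc,
      tensorHoms_comp, id_tensorHom, leftUnitor_naturality_assoc]
  | _ + 1, _, _, rfl, _, _, _, _, W, W', b, c, b', c', u, v, w, hb, hc =>
    associator_square (hb 0) (appendHom_naturality rfl (W := fun x => W x.succ)
      (W' := fun x => W' x.succ) (w := fun x => w x.succ) (fun j => hb j.succ) hc)

theorem Coh.appendHom : ∀ {m n N : ℕ} (h : N = n + m) {U : Fin m → C}
    {V : Fin n → C} {W : Fin N → C}
    {b : ∀ j : Fin m, U j ⟶ W ⟨j, by omega⟩} {c : ∀ i : Fin n, V i ⟶ W ⟨i + m, by omega⟩}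
    (_ : ∀ j, Coh (b j)) (_ : ∀ i, Coh (c i)), Coh (appendHom h b c)
  | 0, _, _, rfl, _, _, _, _, _, _, hc => (Coh.leftUnitor _).comp (Coh.tensorHoms hc)
  | _ + 1, _, _, rfl, _, _, W, _, _, hb, hc =>
    (Coh.associator _ _ _).comp
      ((hb 0).tensor (Coh.appendHom (W := fun x => W x.succ) rfl (fun j => hb j.succ) hc))

/-- The morphism from `V₀ ⊗ ⋯ ⊗ Vₖ ⊗ ⋯` to the tensor product of the sequence `W` of length `N`,
obtained by sending `Vₖ` to the tensor product of `U` by `a`, removing the parentheses around `U`,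
and mapping the entries to those of `W` by `b` (inside the inserted block) and `c` (outside of it).
-/
def assemble : ∀ {n m N : ℕ} (k : Fin n) (h : N + 1 = n + m) {V : Fin n → C} {U : Fin m → C}
    {W : Fin N → C} (_ : V k ⟶ tensorObjs U) (_ : ∀ j, U j ⟶ W (innerPos k h j))
    (_ : ∀ i hi, V i ⟶ W (outerPos k h i hi)), tensorObjs V ⟶ tensorObjs W
  | _ + 1, _, _, ⟨0, _⟩, h, V, _, W, a, b, c =>
    (a ⊗ₘ 𝟙 (tensorObjs fun i => V i.succ)) ≫
      appendHom (by omega) (fun j => b j ≫ castPos W (head_zero_innerPos h j))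
        (fun i => c i.succ _ ≫ castPos W (tail_zero_outerPos h i))
  | n + 1, m, 0, ⟨k + 1, hk⟩, h, _, _, _, _, _, _ => absurd h (by omega)
  | n + 1, m, N + 1, ⟨k + 1, hk⟩, h, V, _, W, a, b, c =>
    (c 0 _ ≫ castPos W (head_outerPos hk h)) ⊗ₘ
      assemble (V := fun i => V i.succ) (W := fun x => W x.succ) ⟨k, Nat.lt_of_succ_lt_succ hk⟩
        (by omega) a (fun j => b j ≫ castPos W (tail_innerPos hk h j))
        (fun i hi => c i.succ _ ≫ castPos W (tail_outerPos hk h i hi))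

theorem assemble_naturality : ∀ {n m N : ℕ} (k : Fin n) (h : N + 1 = n + m) {V V' : Fin n → C}
    {U U' : Fin m → C} {W W' : Fin N → C} {a : V k ⟶ tensorObjs U}
    {b : ∀ j, U j ⟶ W (innerPos k h j)} {c : ∀ i hi, V i ⟶ W (outerPos k h i hi)}
    {a' : V' k ⟶ tensorObjs U'}
    {b' : ∀ j, U' j ⟶ W' (innerPos k h j)} {c' : ∀ i hi, V' i ⟶ W' (outerPos k h i hi)}
    {u : ∀ j, U j ⟶ U' j} {v : ∀ i, V i ⟶ V' i} {w : ∀ x, W x ⟶ W' x}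
    (_ : a ≫ tensorHoms u = v k ≫ a') (_ : ∀ j, b j ≫ w _ = u j ≫ b' j)
    (_ : ∀ i hi, c i hi ≫ w _ = v i ≫ c' i hi),
    assemble k h a b c ≫ tensorHoms w = tensorHoms v ≫ assemble k h a' b' c'
  | _ + 1, _, _, ⟨0, _⟩, h, V, V', _, _, W, W', a, b, c, a', b', c', u, v, w, ha, hb, hc => by
    refine whisker_square (y := tensorHoms u) ha (appendHom_naturality _ (fun j => ?_) fun i => ?_)
    ·       rw [Category.assoc, castPos_naturality, ← Category.assoc, hb, Category.assoc]
    ·       rw [Category.assoc, castPos_naturality, ← Category.assoc, hc, Category.assoc]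
  | n + 1, m, 0, ⟨k + 1, hk⟩, h, _, _, _, _, _, _, _, _, _, _, _, _, _, _, _, _, _, _ =>
    absurd h (by omega)
  | n + 1, m, N + 1, ⟨k + 1, hk⟩, h, V, V', _, _, W, W', a, b, c, a', b', c', u, v, w,
      ha, hb, hc => by
    refine tensor_square ?_ ?_
    · rw [Category.assoc, castPos_naturality, ← Category.assoc, hc, Category.assoc]
    refine assemble_naturality (V := fun i => V i.succ) (W := fun x => W x.succ)
      (V' := fun i => V' i.succ) (W' := fun x => W' x.succ) (w := fun x => w x.succ)
      (v := fun i => v i.succ)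
      ⟨k, Nat.lt_of_succ_lt_succ hk⟩ (by omega) ha (fun j => ?_) (fun i hi => ?_)
    · rw [Category.assoc, castPos_naturality, ← Category.assoc, hb, Category.assoc]
    · rw [Category.assoc, castPos_naturality, ← Category.assoc, hc, Category.assoc]

theorem Coh.assemble : ∀ {n m N : ℕ} (k : Fin n) (h : N + 1 = n + m) {V : Fin n → C}
    {U : Fin m → C} {W : Fin N → C} {a : V k ⟶ tensorObjs U}
    {b : ∀ j, U j ⟶ W (innerPos k h j)} {c : ∀ i hi, V i ⟶ W (outerPos k h i hi)}
    (_ : Coh a) (_ : ∀ j, Coh (b j)) (_ : ∀ i hi, Coh (c i hi)), Coh (assemble k h a b c)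
  | _ + 1, _, _, ⟨0, _⟩, h, V, _, W, a, b, c, ha, hb, hc =>
    (Coh.tensor ha (Coh.eqToHom rfl)).comp
      (Coh.appendHom _ (fun j => (hb j).comp (Coh.castPos _ _))
        (fun _ => (hc _ _).comp (Coh.castPos _ _)))
  | n + 1, m, 0, ⟨k + 1, hk⟩, h, _, _, _, _, _, _, _, _, _ => absurd h (by omega)
  | n + 1, m, N + 1, ⟨k + 1, hk⟩, h, V, _, W, a, b, c, ha, hb, hc =>
    ((hc _ _).comp (Coh.castPos _ _)).tensor
      (Coh.assemble (V := fun i => V i.succ) (W := fun x => W x.succ)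
        ⟨k, Nat.lt_of_succ_lt_succ hk⟩ (by omega) ha (fun j => (hb j).comp (Coh.castPos _ _))
        (fun _ _ => (hc _ _).comp (Coh.castPos _ _)))

/-- The pointwise tensor product of a finite sequence of functors. -/
def tensorFunctor {Q : Type*} [Category* Q] {n : ℕ} (W : Fin n → Q ⥤ C) : Q ⥤ C where
  obj q := tensorObjs fun i => (W i).obj q
  map g := tensorHoms fun i => (W i).map g
  map_id q := (congrArg tensorHoms (funext fun i => (W i).map_id q)).trans (tensorHoms_id _)
  map_comp g g' :=
    (congrArg tensorHoms (funext fun i => (W i).map_comp g g')).trans (tensorHoms_comp _ _)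

/-- The cone over a tensor product of functors that `assemble` makes out of a cone over the
inserted block. -/
def assembleCone {Q : Type*} [Category* Q] {n m N : ℕ} (k : Fin n) (h : N + 1 = n + m)
    {V : Fin n → C} {U : Fin m → Q ⥤ C} {W : Fin N → Q ⥤ C}
    (a : (Functor.const Q).obj (V k) ⟶ tensorFunctor U) (b : ∀ j, U j ⟶ W (innerPos k h j))
    (c : ∀ i hi, (Functor.const Q).obj (V i) ⟶ W (outerPos k h i hi)) :
    Cone (tensorFunctor W) where
  pt := tensorObjs V
  π :=
    { app := fun q => assemble (V := V) (U := fun j => (U j).obj q) (W := fun x => (W x).obj q) k h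
        (a.app q) (fun j => (b j).app q) (fun i hi => (c i hi).app q)
      naturality := fun q q' g => by
        refine (Category.id_comp _).trans ?_
        refine Eq.trans ?_ (assemble_naturality (v := fun i => 𝟙 (V i))
          (u := fun j => (U j).map g) (w := fun x => (W x).map g)
          k h (a := a.app q) (a' := a.app q') (b := fun j => (b j).app q)
          (b' := fun j => (b j).app q') (c := fun i hi => (c i hi).app q)
          (c' := fun i hi => (c i hi).app q') ?_ ?_ ?_).symm
        · rw [tensorHoms_id, Category.id_comp]
        · exact (a.naturality g).symm
        · exact fun j => ((b j).naturality g).symm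
        · exact fun i hi => ((c i hi).naturality g).symm }

/-- As tensoring with an object preserves finite limits, inserting a limit cone into a tensor
product that is constant, up to coherence, in the other positions gives a limit cone. -/
theorem nonempty_isLimit_assembleCone {Q : Type} [SmallCategory Q] [FinCategory Q]
    [∀ X : C, PreservesFiniteLimits (tensorLeft X)]
    [∀ X : C, PreservesFiniteLimits (tensorRight X)] :
    ∀ {n m N : ℕ} (k : Fin n) (h : N + 1 = n + m) {V : Fin n → C} {U : Fin m → Q ⥤ C}
    {W : Fin N → Q ⥤ C} (a : (Functor.const Q).obj (V k) ⟶ tensorFunctor U)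
    (b : ∀ j, U j ⟶ W (innerPos k h j))
    (c : ∀ i hi, (Functor.const Q).obj (V i) ⟶ W (outerPos k h i hi))
    (_ : ∀ j q, Coh ((b j).app q)) (_ : ∀ i hi q, Coh ((c i hi).app q))
    (_ : Nonempty (IsLimit (Cone.mk _ a))), Nonempty (IsLimit (assembleCone k h a b c))
  | _ + 1, _, _, ⟨0, _⟩, h, V, U, W, a, b, c, hb, hc, ⟨ha⟩ => by
    let θ : ∀ q, (tensorFunctor U).obj q ⊗ tensorObjs (fun i => V i.succ) ⟶
        (tensorFunctor W).obj q := fun q =>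
      appendHom (W := fun x => (W x).obj q) (by omega)
        (fun j => (b j).app q ≫ castPos (fun x => (W x).obj q) (head_zero_innerPos h j))
        (fun i => (c i.succ _).app q ≫ castPos (fun x => (W x).obj q) (tail_zero_outerPos h i))
    have hθ : ∀ q, IsIso (θ q) := fun q =>
      (Coh.appendHom (W := fun x => (W x).obj q) _
        (fun j => (hb j q).comp (Coh.castPos (fun x => (W x).obj q) (head_zero_innerPos h j)))
        (fun i => (hc i.succ _ q).comp
          (Coh.castPos (fun x => (W x).obj q) (tail_zero_outerPos h i)))).1
    have nat : ∀ q q' (g : q ⟶ q'), (tensorFunctor U).map g ▷ tensorObjs (fun i => V i.succ) ≫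
        θ q' = θ q ≫ (tensorFunctor W).map g := fun q q' g => by
      rw [← tensorHom_id, ← tensorHoms_id]
      refine (appendHom_naturality _ (fun j => ?_) fun i => ?_).symm
      · rw [Category.assoc, castPos_naturality (fun x => (W x).map g), ← Category.assoc,
          ← (b j).naturality, Category.assoc]
      · rw [Category.assoc, castPos_naturality (fun x => (W x).map g), ← Category.assoc,
          ← (c i.succ _).naturality, Category.assoc]
        rfl
    refine ⟨isLimitOfIso (isLimitOfPreserves (tensorRight (tensorObjs fun i => V i.succ)) ha)
      (Iso.refl _) (NatIso.ofComponents (fun q => asIso (θ q)) fun {q q'} g => nat q q' g) ?_⟩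
    intro q
    refine (Category.id_comp _).trans ?_
    exact congrArg (· ≫ θ q) (tensorHom_id _ _).symm
  | n + 1, m, 0, ⟨k + 1, hk⟩, h, _, _, _, _, _, _, _, _, _ => absurd h (by omega)
  | n + 1, m, N + 1, ⟨k + 1, hk⟩, h, V, U, W, a, b, c, hb, hc, ha => by
    have cast : ∀ {x y : Fin (N + 1)} (e : x = y), W x = W y := fun e => congrArg W e
    obtain ⟨l⟩ := nonempty_isLimit_assembleCone (V := fun i => V i.succ) (W := fun x => W x.succ)
      ⟨k, Nat.lt_of_succ_lt_succ hk⟩ (by omega) a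
      (fun j => b j ≫ eqToHom (cast (tail_innerPos hk h j)))
      (fun i hi => c i.succ _ ≫ eqToHom (cast (tail_outerPos hk h i hi)))
      (fun j q => (hb j q).comp (by rw [eqToHom_app]; exact Coh.eqToHom _))
      (fun i hi q => (hc i.succ _ q).comp (by rw [eqToHom_app]; exact Coh.eqToHom _)) ha
    let θ : ∀ q, V 0 ⟶ (W 0).obj q := fun q => (c 0 _).app q ≫
      castPos (fun x => (W x).obj q) (head_outerPos hk h)
    have hθ : ∀ q, IsIso (θ q) := fun q =>
      ((hc 0 _ q).comp (Coh.castPos (fun x => (W x).obj q) (head_outerPos hk h))).1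
    have nat : ∀ q q' (g : q ⟶ q'), θ q ≫ (W 0).map g = θ q' := fun q q' g => by
      dsimp only [θ]
      rw [Category.assoc, castPos_naturality (fun x => (W x).map g), ← Category.assoc,
          ← (c 0 _).naturality]
      exact congrArg (· ≫ castPos (fun x => (W x).obj q') _) (Category.id_comp _)
    let φ : tensorFunctor (fun x => W x.succ) ⋙ tensorLeft (V 0) ≅ tensorFunctor W :=
      NatIso.ofComponents (fun q =>
        (asIso (θ q) ⊗ᵢ Iso.refl (tensorObjs fun x : Fin N => (W x.succ).obj q)))
        fun {q q'} g => by
          refine (congrArg (· ≫ _) (id_tensorHom _ _).symm).trans (tensor_square ?_ ?_)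
          · exact (Category.id_comp _).trans (nat q q' g).symm
          · exact (Category.comp_id _).trans (Category.id_comp _).symm
    refine ⟨isLimitOfIso (isLimitOfPreserves (tensorLeft (V 0)) l) (Iso.refl _) φ ?_⟩
    intro q
    refine (Category.id_comp _).trans ((congrArg (· ≫ _) (id_tensorHom _ _).symm).trans ?_)
    refine (tensorHom_comp_tensorHom _ _ _ _).trans ?_
    refine congrArg₂ (· ⊗ₘ ·) (Category.id_comp _) ((Category.comp_id _).trans ?_)
    simp only [assembleCone, NatTrans.comp_app, eqToHom_app, castPos]
    rfl

end assembly

/-! ### Cubical functors and grafting -/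

section cubes

attribute [local instance] CategoryStruct.toQuiver

variable {C : Type u} [Category.{v} C]

/-- The indicator of `i ∈ I`, as an element of the poset `{0 < 1}`. -/
noncomputable def ind {n : ℕ} (i : Fin n) (I : Set (Fin n)) : Fin 2 :=
  open Classical in if i ∈ I then 1 else 0

theorem ind_of_mem {n : ℕ} {i : Fin n} {I : Set (Fin n)} (h : i ∈ I) : ind i I = 1 := if_pos h

theorem ind_of_notMem {n : ℕ} {i : Fin n} {I : Set (Fin n)} (h : i ∉ I) : ind i I = 0 := if_neg h

theorem ind_le {n N : ℕ} {i : Fin n} {I : Set (Fin n)} {x : Fin N} {X : Set (Fin N)}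
    (h : i ∈ I → x ∈ X) : ind i I ≤ ind x X := by
  by_cases hi : i ∈ I
  · rw [ind_of_mem hi, ind_of_mem (h hi)]
  · rw [ind_of_notMem hi]
    exact Fin.zero_le _

/-- The functor `{0 → 1} ⥤ C` given by an arrow. The factors of `cube f` at `I` are the values of
the `step (f i)` at the indicators of `i ∈ I`, so that all structure maps between such factors are
images of arrows of a poset, and commute automatically. -/
def step (f : Arrow C) : Fin 2 ⥤ C := ComposableArrows.mk₁ f.hom

/-- The transformation given by a commutative square. -/
def stepMap {f g : Arrow C} (α : f ⟶ g) : step f ⟶ step g :=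
  ComposableArrows.homMk₁ α.left α.right α.w.symm

theorem step_map_comm (f : Arrow C) {a b c d : Fin 2} (p : a ⟶ b) (q : b ⟶ d) (r : a ⟶ c)
    (s : c ⟶ d) : (step f).map p ≫ (step f).map q = (step f).map r ≫ (step f).map s := by
  rw [← Functor.map_comp, ← Functor.map_comp]
  congr 1

variable [MonoidalCategory C]

theorem cube_map_comm {n : ℕ} (f : Fin n → Arrow C) {A B X Y : Set (Fin n)} (p : A ⟶ B)
    (q : B ⟶ Y) (r : A ⟶ X) (s : X ⟶ Y) :
    (cube f).map p ≫ (cube f).map q = (cube f).map r ≫ (cube f).map s := by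
  rw [← Functor.map_comp, ← Functor.map_comp]
  congr 1

theorem coh_eqToHom_app {f g : Arrow C} (e : f = g) (b : Fin 2) :
    Coh ((eqToHom (congrArg step e)).app b) := by
  rw [eqToHom_app]
  exact Coh.eqToHom _

theorem cube_map_trans {n : ℕ} (f : Fin n → Arrow C) {A B X : Set (Fin n)} (p : A ⟶ B)
    (q : B ⟶ X) (r : A ⟶ X) : (cube f).map p ≫ (cube f).map q = (cube f).map r := by
  rw [← Functor.map_comp]
  congr 1

section graft

variable {Q : Type} [SmallCategory Q] {n m N : ℕ} (k : Fin n) (h : N + 1 = n + m)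
  (f : Fin N → Arrow C) (F : Arrow C) (B : Fin 2 × Q ⥤ Set (Fin m))
  (Ψ : ∀ b q, (step F).obj b ⟶ (cube fun j => f (innerPos k h j)).obj (B.obj (b, q)))
  (T : Set (Fin n) × Q ⥤ Set (Fin N))
  (hT_outer : ∀ A q i hi, outerPos k h i hi ∈ T.obj (A, q) ↔ i ∈ A)
  (hT_inner : ∀ A q j, innerPos k h j ∈ T.obj (A, q) ↔ j ∈ B.obj (ind k A, q))

/-- Suppose that `F` replaces the block of arrows `f (innerPos k h j)`, and that it maps by `Ψ` to
their cubical functor, the index `q ∈ Q` and the end `b` of `F` determining the vertex `B (b, q)`.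
If `T (A, q)` agrees with `A` outside the block and with `B` on it, then the cube on the grafted
sequence maps at `A` to the cube on `f` at `T (A, q)`. -/
noncomputable def graftMap (A : Set (Fin n)) (q : Q) :
    (cube (graft k h f F)).obj A ⟶ (cube f).obj (T.obj (A, q)) :=
  assemble k h (V := fun i => (step (graft k h f F i)).obj (ind i A))
    (U := fun j => (step (f (innerPos k h j))).obj (ind j (B.obj (ind k A, q))))
    (W := fun x => (step (f x)).obj (ind x (T.obj (A, q))))
    ((eqToHom (congrArg step (graft_self k h f F))).app _ ≫ Ψ (ind k A) q)
    (fun j => (step (f _)).map (homOfLE (ind_le (hT_inner A q j).2)))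
    (fun i hi => (eqToHom (congrArg step (graft_ne k h f F hi))).app _ ≫
      (step (f _)).map (homOfLE (ind_le (hT_outer A q i hi).2)))

theorem coh_graftMap (A : Set (Fin n)) (q : Q) (hΨ : Coh (Ψ (ind k A) q)) :
    Coh (graftMap k h f F B Ψ T hT_outer hT_inner A q) :=
  Coh.assemble k h ((coh_eqToHom_app (graft_self k h f F) _).comp hΨ)
    (fun j => Coh.map_of_le_of_le _ _ (ind_le (hT_inner A q j).1))
    (fun i hi => (coh_eqToHom_app (graft_ne k h f F hi) _).comp
      (Coh.map_of_le_of_le _ _ (ind_le (hT_outer A q i hi).1)))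

variable (nat : ∀ {b b' : Fin 2} (p : b ⟶ b') {q q' : Q} (g : q ⟶ q'),
    Ψ b q ≫ (cube fun j => f (innerPos k h j)).map (B.map (Prod.mkHom p g)) =
      (step F).map p ≫ Ψ b' q')

include nat

theorem graftMap_naturality {A A' : Set (Fin n)} (p : A ⟶ A') {q q' : Q} (g : q ⟶ q') :
    graftMap k h f F B Ψ T hT_outer hT_inner A q ≫ (cube f).map (T.map (Prod.mkHom p g)) =
      (cube (graft k h f F)).map p ≫ graftMap k h f F B Ψ T hT_outer hT_inner A' q' := by
  have hk : ind k A ≤ ind k A' := ind_le fun h => leOfHom p h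
  refine assemble_naturality k h
    (u := fun j => (cubeFactor (f (innerPos k h j)) j).map (B.map (Prod.mkHom (homOfLE hk) g)))
    ?_ (fun j => ?_) (fun i hi => ?_)
  · refine (Category.assoc _ _ _).trans ((congrArg (_ ≫ ·) (nat (homOfLE hk) g)).trans ?_)
    exact ((eqToHom (congrArg step (graft_self k h f F))).naturality_assoc _ _).symm
  · exact step_map_comm (f (innerPos k h j)) (homOfLE (ind_le (hT_inner A q j).2))
      (homOfLE (ind_le fun hx => leOfHom (T.map (Prod.mkHom p g)) hx))
      (homOfLE (ind_le fun hx => leOfHom (B.map (Prod.mkHom (homOfLE hk) g)) hx)) _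
  · refine (Category.assoc _ _ _).trans ((congrArg (_ ≫ ·) (step_map_comm _ _
      (homOfLE (ind_le fun hx => leOfHom (T.map (Prod.mkHom p g)) hx))
      (homOfLE (ind_le fun h => leOfHom p h))
      (homOfLE (ind_le (hT_outer A' q' i hi).2)))).trans ?_)
    exact ((eqToHom (congrArg step (graft_ne k h f F hi))).naturality_assoc _ _).symm

/-- If both ends of `F` are limits over `Q` of the cubical functor on the block, then the vertices
of the grafted cube are limits over `Q` of the cube on `f`. -/
theorem nonempty_isLimit_graftMap [FinCategory Q]
    [∀ X : C, PreservesFiniteLimits (tensorLeft X)]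
    [∀ X : C, PreservesFiniteLimits (tensorRight X)]
    (hlim : ∀ b, Nonempty (IsLimit (partialCone (cube fun j => f (innerPos k h j)) B b (Ψ b)
      fun g => by rw [nat, CategoryTheory.Functor.map_id, Category.id_comp]))) (A : Set (Fin n)) :
    Nonempty (IsLimit (partialCone (cube f) T A
      (graftMap k h f F B Ψ T hT_outer hT_inner A)
      fun g => by
        rw [graftMap_naturality k h f F B Ψ T hT_outer hT_inner nat, CategoryTheory.Functor.map_id,
          Category.id_comp])) := by
  let U : Fin m → Q ⥤ C := fun j =>
    (Prod.sectR (ind k A) Q ⋙ B) ⋙ cubeFactor (f (innerPos k h j)) j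
  let W : Fin N → Q ⥤ C := fun x => (Prod.sectR A Q ⋙ T) ⋙ cubeFactor (f x) x
  let V : Fin n → C := fun i => (step (graft k h f F i)).obj (ind i A)
  let a : (Functor.const Q).obj (V k) ⟶ tensorFunctor U :=
    { app := fun q => (eqToHom (congrArg step (graft_self k h f F))).app _ ≫ Ψ (ind k A) q
      naturality := fun q q' g => by
        have := nat (𝟙 (ind k A)) g
        rw [CategoryTheory.Functor.map_id, Category.id_comp] at this
        exact (Category.id_comp _).trans
          ((congrArg (_ ≫ ·) this.symm).trans (Category.assoc _ _ _).symm) }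
  let b : ∀ j, U j ⟶ W (innerPos k h j) := fun j =>
    { app := fun q => (step (f _)).map (homOfLE (ind_le (hT_inner A q j).2))
      naturality := fun q q' g => step_map_comm _
        (homOfLE (ind_le fun hx => leOfHom (B.map (Prod.mkHom (𝟙 (ind k A)) g)) hx)) _ _
        (homOfLE (ind_le fun hx => leOfHom (T.map (Prod.mkHom (𝟙 A) g)) hx)) }
  let c : ∀ i hi, (Functor.const Q).obj (V i) ⟶ W (outerPos k h i hi) := fun i hi =>
    { app := fun q => (eqToHom (congrArg step (graft_ne k h f F hi))).app _ ≫
        (step (f _)).map (homOfLE (ind_le (hT_outer A q i hi).2))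
      naturality := fun q q' g => by
        refine (Category.id_comp _).trans ?_
        refine Eq.trans ?_ (Category.assoc _ _ _).symm
        refine congrArg (_ ≫ ·) ?_
        exact ((step (f _)).map_comp (homOfLE (ind_le (hT_outer A q i hi).2))
          (homOfLE (ind_le fun hx => leOfHom (T.map (Prod.mkHom (𝟙 A) g)) hx))) }
  obtain ⟨l⟩ := hlim (ind k A)
  refine nonempty_isLimit_assembleCone (U := U) (W := W) (V := V) k h a b c ?_ ?_ ⟨?_⟩
  · exact fun j q => Coh.map_of_le_of_le (step (f (innerPos k h j)))
      (homOfLE (ind_le (hT_inner A q j).2)) (ind_le (hT_inner A q j).1)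
  · exact fun i hi q => (coh_eqToHom_app (graft_ne k h f F hi) _).comp
      (Coh.map_of_le_of_le _ _ (ind_le (hT_outer A q i hi).1))
  · refine isLimitOfIso l
      ((eqToIso (congrArg step (graft_self k h f F))).app (ind k A)) (Iso.refl _) ?_
    intro q
    exact congrArg (_ ≫ ·) (Category.comp_id _)

end graft

/-! ### Projections of the polyhedral limits -/

section projections

variable [HasFiniteLimits C] {n : ℕ} (K : SComplex n) (f : Fin n → Arrow C)

/-- The projection of a polyhedral limit to the vertex complementary to a face; a rephrasing of
`limit.π` in terms of `cube`. -/
noncomputable def polyProj (I : K.Faceᵒᵖ) : limit (coCube K f) ⟶ (cube f).obj (I.unop.1ᶜ) :=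
  limit.π (coCube K f) I

/-- The arrow `polyLimit K f`, as a morphism. -/
noncomputable def polyOut : limit (coCube K f) ⟶ (cube f).obj Set.univ := (polyLimit K f).hom

/-- The arrow `polyLimitComp K f`, as a morphism. -/
noncomputable def polyIn : (cube f).obj ∅ ⟶ limit (coCube K f) := (polyLimitComp K f).hom

variable {K f}

theorem polyProj_map {I J : K.Faceᵒᵖ} (p : I.unop.1ᶜ ⟶ J.unop.1ᶜ) :
    polyProj K f I ≫ (cube f).map p = polyProj K f J :=
  limit.w (coCube K f) (Quiver.Hom.op (homOfLE (Set.compl_subset_compl.1 (leOfHom p))) : I ⟶ J)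

theorem polyProj_map_univ (I : K.Faceᵒᵖ) (p : I.unop.1ᶜ ⟶ Set.univ) :
    polyProj K f I ≫ (cube f).map p = polyOut K f := by
  have h₁ : polyOut K f = polyProj K f (op ⟨∅, K.empty_mem⟩) ≫ (cube f).map _ := rfl
  rw [h₁, ← polyProj_map (I := I) (J := op ⟨∅, K.empty_mem⟩)
    (homOfLE (Set.compl_subset_compl.2 (Set.empty_subset _))),
    Category.assoc, cube_map_trans f _ _ p]

theorem polyIn_proj (I : K.Faceᵒᵖ) (p : ∅ ⟶ I.unop.1ᶜ) :
    polyIn K f ≫ polyProj K f I = (cube f).map p :=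
  limit.lift_π _ _

end projections

/-! ### Comparison of polyhedral limits -/

section compare

variable [HasFiniteLimits C] {Q : Type} [SmallCategory Q] {n N : ℕ} {K : SComplex n}
  {M : SComplex N} {g : Fin n → Arrow C} {f : Fin N → Arrow C} (T : Set (Fin n) × Q ⥤ Set (Fin N))
  (π : ∀ A q, (cube g).obj A ⟶ (cube f).obj (T.obj (A, q)))
  (nat : ∀ {A A' : Set (Fin n)} (p : A ⟶ A') {q q' : Q} (r : q ⟶ q'),
    π A q ≫ (cube f).map (T.map (Prod.mkHom p r)) = (cube g).map p ≫ π A' q')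
  (hlim : ∀ A, Nonempty (IsLimit (partialCone (cube f) T A (π A)
    fun r => by rw [nat, CategoryTheory.Functor.map_id, Category.id_comp])))
  (S : K.Faceᵒᵖ × Q ⥤ M.Faceᵒᵖ) [S.Initial]
  (hS : ∀ I q, (S.obj (I, q)).unop.1ᶜ = T.obj (I.unop.1ᶜ, q))

include nat hlim hS

/-- If the vertices of the cube on `g` are limits over `Q` of vertices of the cube on `f`, and the
faces of `K`, together with `Q`, are initial in those of `M`, then the two polyhedral limits agree.
-/
theorem exists_limit_coCube_iso :
    ∃ e : limit (coCube M f) ≅ limit (coCube K g), ∀ I q,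
      e.hom ≫ polyProj K g I ≫ π (I.unop.1ᶜ) q =
        polyProj M f (S.obj (I, q)) ≫ (cube f).map (homOfLE (hS I q).le) := by
  let φ : ∀ I q, (coCube K g).obj I ⟶ (coCube M f).obj (S.obj (I, q)) := fun I q =>
    π (I.unop.1ᶜ) q ≫ (cube f).map (homOfLE (hS I q).ge)
  have hφ : ∀ {I I'} (p : I ⟶ I') {q q' : Q} (r : q ⟶ q'),
      φ I q ≫ (coCube M f).map (S.map (Prod.mkHom p r)) = (coCube K g).map p ≫ φ I' q' := by
    intro I I' p q q' r
    have := nat (K.coface.map p) r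
    refine (Category.assoc _ _ _).trans ?_
    refine (congrArg (_ ≫ ·) (cube_map_comm f _ _ (T.map (Prod.mkHom (K.coface.map p) r))
      (homOfLE (hS I' q').ge))).trans ?_
    refine (Category.assoc _ _ _).symm.trans ((congrArg (· ≫ _) this).trans ?_)
    exact Category.assoc _ _ _
  obtain ⟨e, he⟩ := exists_limit_iso (coCube M f) (coCube K g) S φ hφ fun I => by
    obtain ⟨l⟩ := hlim (I.unop.1ᶜ)
    refine ⟨isLimitOfIso l (Iso.refl _) (NatIso.ofComponents (fun q =>
      (cube f).mapIso (eqToIso (hS I q).symm)) fun r => cube_map_comm f _ _ _ _) fun q => ?_⟩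
    refine (Category.id_comp _).trans (congrArg (_ ≫ ·) (congrArg (cube f).map ?_))
    exact Subsingleton.elim _ _
  refine ⟨e, fun I q => ?_⟩
  have he' : e.hom ≫ polyProj K g I ≫ π (I.unop.1ᶜ) q ≫ (cube f).map (homOfLE (hS I q).ge) =
    polyProj M f (S.obj (I, q)) := he I q
  rw [← he']
  simp only [Category.assoc]
  rw [cube_map_trans f _ _ (𝟙 _), CategoryTheory.Functor.map_id, Category.comp_id]

/-- Under this isomorphism of limits the projections to the top vertices correspond. -/
theorem exists_iso_polyOut (q : Q) :
    ∃ e : limit (coCube M f) ≅ limit (coCube K g),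
      polyOut M f = e.hom ≫ polyOut K g ≫ π Set.univ q ≫
        (cube f).map (homOfLE (Set.subset_univ _)) := by
  obtain ⟨e, he⟩ := exists_limit_coCube_iso T π nat hlim S hS
  refine ⟨e, ?_⟩
  let I : K.Faceᵒᵖ := op ⟨∅, K.empty_mem⟩
  let p : I.unop.1ᶜ ⟶ Set.univ := homOfLE (Set.subset_univ _)
  rw [← polyProj_map_univ I p, Category.assoc, ← reassoc_of% (nat p (𝟙 q)),
    cube_map_trans f _ _ (homOfLE (Set.subset_univ _)), reassoc_of% (he I q),
    cube_map_trans f _ _ (homOfLE (Set.subset_univ _)), polyProj_map_univ]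

/-- The arrows from the bottom vertices correspond as well. The map `π ∅ q` out of the bottom vertex
does not depend on `q` when `Q` has a weakly terminal object `q₀`, and is then given by `π ∅ q₀`. -/
theorem exists_iso_polyIn (q₀ : Q) (hq₀ : ∀ q, Nonempty (q ⟶ q₀)) (hT : T.obj (∅, q₀) = ∅) :
    ∃ e : limit (coCube M f) ≅ limit (coCube K g),
      polyIn K g = (π ∅ q₀ ≫ (cube f).map (homOfLE hT.le)) ≫ polyIn M f ≫ e.hom := by
  obtain ⟨e, he⟩ := exists_limit_coCube_iso T π nat hlim S hS
  have ext : ∀ {X : C} {a b : X ⟶ limit (coCube K g)}, (∀ I q, a ≫ polyProj K g I ≫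
      π (I.unop.1ᶜ) q = b ≫ polyProj K g I ≫ π (I.unop.1ᶜ) q) → a = b := fun {X a b} H =>
    limit.hom_ext fun I => (hlim (I.unop.1ᶜ)).some.hom_ext fun q =>
      (Category.assoc _ _ _).trans ((H I q).trans (Category.assoc _ _ _).symm)
  refine ⟨e, ext fun I q => ?_⟩
  obtain ⟨r⟩ := hq₀ q
  let p : ∅ ⟶ I.unop.1ᶜ := homOfLE (Set.empty_subset _)
  have h₃ := nat p (𝟙 q)
  have h₄ := nat (𝟙 ∅) r
  rw [CategoryTheory.Functor.map_id, Category.id_comp] at h₄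
  rw [reassoc_of% (polyIn_proj I p), ← h₃, ← h₄]
  simp only [Category.assoc]
  rw [he, reassoc_of% (polyIn_proj (S.obj (I, q)) (homOfLE (Set.empty_subset _)))]
  simp only [← Functor.map_comp]
  congr 1

end compare

end cubes

/-! ### Reordering a tensor product -/

section reorder

attribute [local instance] CategoryStruct.toQuiver

variable {C : Type u} [Category.{v} C] [MonoidalCategory C]

variable (C) in
/-- The permutation `σ` acts on tensor products: families of morphisms `X i ⟶ Y (σ i)` induce
morphisms of tensor products, isomorphisms do so by isomorphisms, and commutative squares by
commutative squares. No relation between the morphisms for different `σ` is asked for, since the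
theorem is about isomorphism classes. -/
def Reorders {n : ℕ} (σ : Equiv.Perm (Fin n)) : Prop :=
  ∃ θ : ∀ {X Y : Fin n → C} (_ : ∀ i, X i ⟶ Y (σ i)), tensorObjs X ⟶ tensorObjs Y,
    (∀ {X Y : Fin n → C} (c : ∀ i, X i ⟶ Y (σ i)), (∀ i, IsIso (c i)) → IsIso (θ c)) ∧
    ∀ {X X' Y Y' : Fin n → C} (c : ∀ i, X i ⟶ Y (σ i)) (c' : ∀ i, X' i ⟶ Y' (σ i))
      (x : ∀ i, X i ⟶ X' i) (y : ∀ i, Y i ⟶ Y' i), (∀ i, c i ≫ y (σ i) = x i ≫ c' i) →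
      θ c ≫ tensorHoms y = tensorHoms x ≫ θ c'

theorem reorders_one (n : ℕ) : Reorders C (1 : Equiv.Perm (Fin n)) := by
  refine ⟨fun c => tensorHoms c, fun c h => isIso_tensorHoms c h, fun c c' x y h => ?_⟩
  exact (tensorHoms_comp _ _).symm.trans
    ((congrArg tensorHoms (funext h)).trans (tensorHoms_comp _ _))

theorem Reorders.mul {n : ℕ} {σ τ : Equiv.Perm (Fin n)} (hσ : Reorders C σ) (hτ : Reorders C τ) :
    Reorders C (σ * τ) := by
  obtain ⟨θ, hθ, nθ⟩ := hσ
  obtain ⟨η, hη, nη⟩ := hτ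
  refine ⟨fun {X Y} c => η (Y := fun i => Y (σ i)) c ≫ θ fun i => 𝟙 (Y (σ i)), fun {X Y} c h => ?_,
    fun {X X' Y Y'} c c' x y h => ?_⟩
  · have := hη (Y := fun i => Y (σ i)) c h
    have := hθ (fun i => 𝟙 (Y (σ i))) fun i => inferInstance
    infer_instance
  · rw [Category.assoc, nθ (fun i => 𝟙 (Y (σ i))) (fun i => 𝟙 (Y' (σ i))) (fun i => y (σ i)) y
      (fun i => (Category.id_comp _).trans (Category.comp_id _).symm), ← Category.assoc,
      nη (Y := fun i => Y (σ i)) (Y' := fun i => Y' (σ i)) c c' x (fun i => y (σ i)) h,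
      Category.assoc]

theorem Reorders.lift {n : ℕ} {σ : Equiv.Perm (Fin (n + 1))} {τ : Equiv.Perm (Fin n)}
    (hτ : Reorders C τ) (h₀ : σ 0 = 0) (h₁ : ∀ i : Fin n, σ i.succ = (τ i).succ) :
    Reorders C σ := by
  obtain ⟨θ, hθ, nθ⟩ := hτ
  refine ⟨fun {X Y} c => (c 0 ≫ castPos Y h₀) ⊗ₘ
      θ (X := fun i => X i.succ) (Y := fun i => Y i.succ) fun i => c i.succ ≫ castPos Y (h₁ i),
    fun {X Y} c h => ?_, fun {X X' Y Y'} c c' x y h => ?_⟩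
  · have cast : ∀ {a b : Fin (n + 1)} (e : a = b), IsIso (castPos Y e) := fun e =>
      (Coh.castPos Y e).1
    have := cast h₀
    have := hθ (X := fun i => X i.succ) (Y := fun i => Y i.succ)
      (fun i => c i.succ ≫ castPos Y (h₁ i)) fun i => by
        have := cast (h₁ i)
        infer_instance
    exact inferInstanceAs (IsIso ((c 0 ≫ castPos Y h₀) ⊗ₘ
      θ (X := fun i => X i.succ) (Y := fun i => Y i.succ) fun i => c i.succ ≫ castPos Y (h₁ i)))
  · refine tensor_square ?_ (nθ _ _ (fun i => x i.succ) (fun i => y i.succ) fun i => ?_)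
    · rw [Category.assoc, castPos_naturality, ← Category.assoc, h, Category.assoc]
    · rw [Category.assoc, castPos_naturality, ← Category.assoc, h, Category.assoc]

section

variable [BraidedCategory C]

/-- The exchange of the two leading factors of a tensor product. -/
def swapFront (X Y Z : C) : X ⊗ (Y ⊗ Z) ⟶ Y ⊗ (X ⊗ Z) :=
  (α_ X Y Z).inv ≫ ((β_ X Y).hom ▷ Z) ≫ (α_ Y X Z).hom

instance (X Y Z : C) : IsIso (swapFront X Y Z) := by
  unfold swapFront
  infer_instance

theorem swapFront_naturality {X Y Z X' Y' Z' : C} (x : X ⟶ X') (y : Y ⟶ Y') (z : Z ⟶ Z') :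
    swapFront X Y Z ≫ (y ⊗ₘ (x ⊗ₘ z)) = (x ⊗ₘ (y ⊗ₘ z)) ≫ swapFront X' Y' Z' := by
  simp only [swapFront, Category.assoc]
  rw [← associator_naturality, associator_inv_naturality_assoc, ← tensorHom_id, ← tensorHom_id,
    tensorHom_comp_tensorHom_assoc, tensorHom_comp_tensorHom_assoc, Category.id_comp,
    Category.comp_id, BraidedCategory.braiding_naturality]

theorem reorders_swap_zero_one (n : ℕ) : Reorders C (Equiv.swap (0 : Fin (n + 2)) 1) := by
  have h₀ : Equiv.swap (0 : Fin (n + 2)) 1 0 = 1 := Equiv.swap_apply_left _ _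
  have h₁ : Equiv.swap (0 : Fin (n + 2)) 1 1 = 0 := Equiv.swap_apply_right _ _
  have h₂ : ∀ i : Fin n, Equiv.swap (0 : Fin (n + 2)) 1 i.succ.succ = i.succ.succ := fun i =>
    Equiv.swap_apply_of_ne_of_ne (Fin.succ_ne_zero _) fun e =>
      Fin.succ_ne_zero i (Fin.succ_injective _ e)
  refine ⟨fun {X Y} c => ((c 0 ≫ castPos Y h₀) ⊗ₘ ((c 1 ≫ castPos Y h₁) ⊗ₘ
      tensorHoms (X := fun i => X i.succ.succ) (Y := fun i => Y i.succ.succ)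
        fun i => c i.succ.succ ≫ castPos Y (h₂ i))) ≫ swapFront (Y 1) (Y 0) _,
    fun {X Y} c h => ?_, fun {X X' Y Y'} c c' x y h => ?_⟩
  · have cast : ∀ {a b : Fin (n + 2)} (e : a = b), IsIso (castPos Y e) := fun e =>
      (Coh.castPos Y e).1
    have := cast h₀
    have := cast h₁
    have := isIso_tensorHoms (X := fun i => X i.succ.succ) (Y := fun i => Y i.succ.succ)
      (fun i => c i.succ.succ ≫ castPos Y (h₂ i)) fun i => by
        have := cast (h₂ i)
        infer_instance
    exact inferInstanceAs (IsIso (((c 0 ≫ castPos Y h₀) ⊗ₘ ((c 1 ≫ castPos Y h₁) ⊗ₘ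
      tensorHoms (X := fun i => X i.succ.succ) (Y := fun i => Y i.succ.succ)
        fun i => c i.succ.succ ≫ castPos Y (h₂ i))) ≫ swapFront (Y 1) (Y 0) _))
  · have key : ∀ {a b : Fin (n + 2)} (e : Equiv.swap (0 : Fin (n + 2)) 1 a = b),
        (c a ≫ castPos Y e) ≫ y b = x a ≫ c' a ≫ castPos Y' e := fun e => by
      rw [Category.assoc, castPos_naturality, ← Category.assoc, h, Category.assoc]
    refine (Category.assoc _ _ _).trans (Eq.trans ?_ (Category.assoc _ _ _))
    refine (congrArg (_ ≫ ·) (swapFront_naturality (y 1) (y 0)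
      (tensorHoms fun i => y i.succ.succ))).trans ?_
    refine (Category.assoc _ _ _).symm.trans (congrArg (· ≫ _) ?_)
    refine tensor_square (key h₀) (tensor_square (key h₁) ?_)
    rw [← tensorHoms_comp]
    refine Eq.trans ?_ (tensorHoms_comp _ _)
    exact congrArg tensorHoms (funext fun i => key (h₂ i))

theorem reorders_swap_castSucc_succ :
    ∀ {n : ℕ} (i : Fin n), Reorders C (Equiv.swap i.castSucc i.succ)
  | n + 1, ⟨0, _⟩ => reorders_swap_zero_one n
  | n + 1, ⟨i + 1, hi⟩ => by
    have e : ∀ j : Fin (n + 1),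
        Equiv.swap (Fin.castSucc ⟨i + 1, hi⟩) (Fin.succ ⟨i + 1, hi⟩) j.succ =
        (Equiv.swap (Fin.castSucc ⟨i, Nat.lt_of_succ_lt_succ hi⟩)
          (Fin.succ ⟨i, Nat.lt_of_succ_lt_succ hi⟩) j).succ := fun j => by
      rw [(Fin.succ_injective (n + 1)).map_swap]
      rfl
    refine (reorders_swap_castSucc_succ ⟨i, Nat.lt_of_succ_lt_succ hi⟩).lift ?_ e
    exact Equiv.swap_apply_of_ne_of_ne
      (Fin.succ_ne_zero (⟨i, Nat.lt_of_succ_lt hi⟩ : Fin (n + 1))).symm (Fin.succ_ne_zero _).symm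

/-- Adjacent transpositions generate the symmetric group, so it is enough to exchange neighbours.
-/
theorem reorders : ∀ {n : ℕ} (σ : Equiv.Perm (Fin n)), Reorders C σ
  | 0, σ => by
    rw [Subsingleton.elim σ 1]
    exact reorders_one 0
  | n + 1, σ => by
    have hσ : σ ∈ Submonoid.closure
        (Set.range fun i : Fin n => Equiv.swap i.castSucc i.succ) := by
      rw [Equiv.Perm.mclosure_swap_castSucc_succ]
      trivial
    induction hσ using Submonoid.closure_induction with
    | mem x hx =>
      obtain ⟨i, rfl⟩ := hx
      exact reorders_swap_castSucc_succ i
    | one => exact reorders_one _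
    | mul x y _ _ hx hy => exact hx.mul hy

end

end reorder

/-! ### The action of the symmetric groups -/

section action

attribute [local instance] CategoryStruct.toQuiver

variable {C : Type u} [Category.{v} C]

theorem arrowClass_eq {f g : Arrow C} (l : f.left ⟶ g.left) (r : f.right ⟶ g.right) (hl : IsIso l)
    (hr : IsIso r) (h : l ≫ g.hom = f.hom ≫ r) : arrowClass f = arrowClass g :=
  Quotient.sound ⟨Arrow.isoMk (asIso l) (asIso r) h⟩

variable [MonoidalCategory C] [BraidedCategory C]

/-- The identification of the faces of `K` with those of `K · σ`. -/
def actFaces {n : ℕ} (K : SComplex n) (σ : Equiv.Perm (Fin n)) :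
    K.Faceᵒᵖ × Discrete PUnit.{1} ⥤ (K.act σ).Faceᵒᵖ where
  obj x := op ⟨σ ⁻¹' x.1.unop.1, by
    change σ '' (σ ⁻¹' x.1.unop.1) ∈ K.faces
    rw [Set.image_preimage_eq _ σ.surjective]
    exact x.1.unop.2⟩
  map p := Quiver.Hom.op (homOfLE (Set.preimage_mono (leOfHom p.1.unop)))

instance {n : ℕ} (K : SComplex n) (σ : Equiv.Perm (Fin n)) : (actFaces K σ).Initial := by
  refine initial_of_thin _ fun X => ⟨(op ⟨σ '' X.unop.1, X.unop.2⟩, ⟨⟨⟩⟩), ⟨?_⟩, fun p ⟨g⟩ => ?_⟩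
  · exact Quiver.Hom.op (homOfLE (Set.preimage_image_eq _ σ.injective).ge)
  · refine ⟨_, _, ⟨?_⟩, ⟨?_⟩, ⟨𝟙 (op ⟨σ '' X.unop.1, X.unop.2⟩, ⟨⟨⟩⟩)⟩, ⟨𝟙 _⟩⟩
    · exact Quiver.Hom.op (homOfLE (Set.preimage_image_eq _ σ.injective).ge)
    · exact Prod.mkHom (Quiver.Hom.op (homOfLE (Set.image_subset_iff.2 (leOfHom g.unop))))
        (eqToHom (Subsingleton.elim _ _))

/-- Permuting a sequence of arrows permutes, up to isomorphism, the vertices of its cube. -/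
theorem exists_reorder_cube {n : ℕ} (σ : Equiv.Perm (Fin n)) {f g : Fin n → Arrow C}
    (ε : ∀ i, g i ≅ f (σ.symm i)) :
    ∃ θ : ∀ A, (cube g).obj A ⟶ (cube f).obj (σ ⁻¹' A), (∀ A, IsIso (θ A)) ∧
      ∀ {A A' : Set (Fin n)} (p : A ⟶ A') (p' : σ ⁻¹' A ⟶ σ ⁻¹' A'),
        θ A ≫ (cube f).map p' = (cube g).map p ≫ θ A' := by
  obtain ⟨θ, hθ, nθ⟩ := reorders (C := C) σ.symm
  have mem : ∀ {i : Fin n} {A : Set (Fin n)}, i ∈ A ↔ σ.symm i ∈ σ ⁻¹' A := fun {i A} => by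
    rw [Set.mem_preimage, Equiv.apply_symm_apply]
  have step_iso : ∀ {a b : Arrow C} (e : a ≅ b) (x : Fin 2), IsIso ((stepMap e.hom).app x) := by
    intro a b e x
    have : IsIso ((stepMap e.hom).app 0) := inferInstanceAs (IsIso e.hom.left)
    have : IsIso ((stepMap e.hom).app 1) := inferInstanceAs (IsIso e.hom.right)
    revert x
    exact Fin.forall_fin_two.2 ⟨‹_›, ‹_›⟩
  refine ⟨fun A => θ (X := fun i => (step (g i)).obj (ind i A))
    (Y := fun i => (step (f i)).obj (ind i (σ ⁻¹' A))) fun i =>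
      (stepMap (ε i).hom).app _ ≫ (step (f (σ.symm i))).map (homOfLE (ind_le mem.1)),
      fun A => hθ _ fun i => ?_, fun {A A'} p p' => nθ _ _ _ _ fun i => ?_⟩
  · have := step_iso (ε i) (ind i A)
    have := (Coh.map_of_le_of_le (step (f (σ.symm i)))
      (homOfLE (ind_le mem.1) : ind i A ⟶ ind (σ.symm i) (σ ⁻¹' A)) (ind_le mem.2)).1
    infer_instance
  · refine (Category.assoc _ _ _).trans ((congrArg (_ ≫ ·) (step_map_comm _ _
      (homOfLE (ind_le fun hx => leOfHom p' hx)) (homOfLE (ind_le fun h => leOfHom p h))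
      (homOfLE (ind_le mem.1)))).trans ?_)
    exact ((stepMap (ε i).hom).naturality_assoc _ _).symm

variable [HasFiniteLimits C]

/-- Equivariance of the polyhedral limits; for `σ = 1` it says that they respect isomorphisms of
arrows. -/
theorem arrowClass_polyLimit_act {n : ℕ} (K : SComplex n) (σ : Equiv.Perm (Fin n))
    {f g : Fin n → Arrow C} (ε : ∀ i, g i ≅ f (σ.symm i)) :
    arrowClass (polyLimit (K.act σ) f) = arrowClass (polyLimit K g) ∧
      arrowClass (polyLimitComp (K.act σ) f) = arrowClass (polyLimitComp K g) := by
  obtain ⟨θ, hθ, nθ⟩ := exists_reorder_cube σ ε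
  let T : Set (Fin n) × Discrete PUnit.{1} ⥤ Set (Fin n) :=
    { obj := fun x => σ ⁻¹' x.1
      map := fun p => homOfLE (Set.preimage_mono (leOfHom p.1)) }
  have nat : ∀ {A A' : Set (Fin n)} (p : A ⟶ A') {q q' : Discrete PUnit.{1}} (r : q ⟶ q'),
      θ A ≫ (cube f).map (T.map (Prod.mkHom p r)) = (cube g).map p ≫ θ A' := fun p _ _ _ =>
    nθ p _
  have hlim := fun A => nonempty_isLimit_of_isIso_legs (partialCone (cube f) T A (fun _ => θ A)
    fun {q q'} r => by
      rw [nat (q := q) (q' := q'), CategoryTheory.Functor.map_id, Category.id_comp]) fun _ => hθ A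
  constructor
  · obtain ⟨e, he⟩ := exists_iso_polyOut T (fun A _ => θ A) nat hlim (actFaces K σ)
      (fun _ _ => rfl) ⟨⟨⟩⟩
    have i₁ := hθ Set.univ
    have i₂ := (Coh.map_of_le_of_le (cube f) (homOfLE (Set.subset_univ _) :
      T.obj (Set.univ, ⟨⟨⟩⟩) ⟶ Set.univ) (Set.preimage_univ).ge).1
    refine (arrowClass_eq (f := polyLimit K g) (g := polyLimit (K.act σ) f) e.inv
      (θ Set.univ ≫ (cube f).map (homOfLE (Set.subset_univ _) :
        T.obj (Set.univ, ⟨⟨⟩⟩) ⟶ Set.univ)) e.isIso_inv (IsIso.comp_isIso' i₁ i₂) ?_).symm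
    exact (Iso.inv_comp_eq e).2 he
  · obtain ⟨e, he⟩ := exists_iso_polyIn T (fun A _ => θ A) nat hlim (actFaces K σ)
      (fun _ _ => rfl) ⟨⟨⟩⟩ (fun q => ⟨eqToHom (Subsingleton.elim _ _)⟩) Set.preimage_empty
    have i₁ := hθ ∅
    have i₂ := (Coh.map_of_le_of_le (cube f) (homOfLE Set.preimage_empty.le :
      T.obj (∅, ⟨⟨⟩⟩) ⟶ ∅) (Set.preimage_empty).ge).1
    refine (arrowClass_eq (f := polyLimitComp K g) (g := polyLimitComp (K.act σ) f)
      (θ ∅ ≫ (cube f).map (homOfLE Set.preimage_empty.le : T.obj (∅, ⟨⟨⟩⟩) ⟶ ∅)) e.inv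
      (IsIso.comp_isIso' i₁ i₂) e.isIso_inv ?_).symm
    refine ((Iso.comp_inv_eq e).2 (he.trans ?_)).symm
    exact (Category.assoc _ _ _).symm

end action

/-! ### Isomorphisms of arrows with a coherence morphism on one side -/

section isoOver

variable {C : Type u} [Category.{v} C] [MonoidalCategory C]

/-- The arrows are isomorphic, by a coherence morphism between their codomains. -/
def CohOver (f g : Arrow C) : Prop :=
  ∃ (e : f.left ≅ g.left) (r : g.right ⟶ f.right), Coh r ∧ f.hom = e.hom ≫ g.hom ≫ r

/-- The arrows are isomorphic, by a coherence morphism between their domains. -/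
def CohUnder (f g : Arrow C) : Prop :=
  ∃ (r : g.left ⟶ f.left) (e : f.right ≅ g.right), Coh r ∧ g.hom = r ≫ f.hom ≫ e.hom

theorem CohOver.arrowClass_eq {f g : Arrow C} (h : CohOver f g) : arrowClass f = arrowClass g := by
  obtain ⟨e, r, hr, h⟩ := h
  exact (PolyLim.arrowClass_eq e.inv r e.isIso_inv hr.1 ((Iso.inv_comp_eq e).2 h)).symm

theorem CohUnder.arrowClass_eq {f g : Arrow C} (h : CohUnder f g) :
    arrowClass f = arrowClass g := by
  obtain ⟨r, e, hr, h⟩ := h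
  refine (PolyLim.arrowClass_eq r e.inv hr.1 e.isIso_inv ?_).symm
  rw [h]
  simp

theorem CohOver.sameOver {f g : Arrow C} (h : CohOver f g) (hC : IsStrict C) : SameOver f g := by
  obtain ⟨e, r, hr, h⟩ := h
  obtain ⟨h', rfl⟩ := hr.2 hC
  exact ⟨h'.symm, e, by simp [h]⟩

theorem CohUnder.sameUnder {f g : Arrow C} (h : CohUnder f g) (hC : IsStrict C) :
    SameUnder f g := by
  obtain ⟨r, e, hr, h⟩ := h
  obtain ⟨h', rfl⟩ := hr.2 hC
  exact ⟨h'.symm, e, by simp [h]⟩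

end isoOver

/-! ### Units -/

section units

attribute [local instance] CategoryStruct.toQuiver

variable {C : Type u} [Category.{v} C] [MonoidalCategory C] [HasFiniteLimits C]

/-- A largest face is initial in the opposite face category, so that the limit is the value there.
-/
theorem isIso_polyProj {n : ℕ} {K : SComplex n} (f : Fin n → Arrow C) (I : K.Face)
    (hI : ∀ J : K.Face, J.1 ⊆ I.1) : IsIso (polyProj K f (op I)) :=
  isIso_π_of_isInitial (IsInitial.ofUniqueHom
    (fun J => Quiver.Hom.op (homOfLE (hI J.unop))) fun _ _ => Subsingleton.elim _ _) (coCube K f)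

omit [HasFiniteLimits C] in
/-- The vertices of the cube on one arrow, which by definition carry a trailing unit object. -/
noncomputable def cubeOneIso (f : Fin 1 → Arrow C) (A : Set (Fin 1)) :
    (cube f).obj A ≅ (step (f 0)).obj (ind 0 A) :=
  ρ_ _

omit [HasFiniteLimits C] in
theorem cube_one_map (f : Fin 1 → Arrow C) {A B : Set (Fin 1)} (p : A ⟶ B) :
    (cube f).map p = (cubeOneIso f A).hom ≫
      (step (f 0)).map (homOfLE (ind_le fun hx => leOfHom p hx)) ≫ (cubeOneIso f B).inv := by
  rw [← Category.assoc, Iso.eq_comp_inv]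
  refine (congrArg (· ≫ _) (tensorHom_id _ _)).trans ?_
  exact rightUnitor_naturality _

theorem cohOver_one (f : Fin 1 → Arrow C) : CohOver (polyLimit substOperad.one f) (f 0) := by
  let K : SComplex 1 := substOperad.one
  let I : K.Face := ⟨{0}, Or.inr rfl⟩
  have hI : IsIso (polyProj K f (op I)) := isIso_polyProj f I fun J => by
    obtain ⟨J, rfl | rfl⟩ := J
    · exact Set.empty_subset _
    · exact subset_rfl
  have h₀ : ind 0 (I.1ᶜ) = 0 := ind_of_notMem fun h => h rfl
  have h₁ : ind (0 : Fin 1) Set.univ = 1 := ind_of_mem trivial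
  let e : limit (coCube K f) ≅ (step (f 0)).obj 0 :=
    asIso (polyProj K f (op I)) ≪≫ cubeOneIso f _ ≪≫ (step (f 0)).mapIso (eqToIso h₀)
  refine ⟨e, (step (f 0)).map (homOfLE h₁.ge) ≫ (cubeOneIso f _).inv,
    (Coh.map_of_le_of_le (step (f 0)) (homOfLE h₁.ge) h₁.le).comp (Coh.rightUnitor_inv _), ?_⟩
  change polyOut K f = e.hom ≫ (step (f 0)).map (homOfLE (Fin.zero_le 1)) ≫
    (step (f 0)).map (homOfLE h₁.ge) ≫ (cubeOneIso f Set.univ).inv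
  rw [← polyProj_map_univ (op I) (homOfLE (Set.subset_univ _)), cube_one_map]
  simp only [e, Iso.trans_hom, asIso_hom, Functor.mapIso_hom, Category.assoc,
    ← Functor.map_comp_assoc]
  rfl

theorem cohUnder_one (f : Fin 1 → Arrow C) :
    CohUnder (polyLimitComp compOperad.one f) (f 0) := by
  let K : SComplex 1 := compOperad.one
  let I : K.Face := ⟨∅, rfl⟩
  have hI : IsIso (polyProj K f (op I)) := isIso_polyProj f I fun J => by
    obtain ⟨J, rfl⟩ := J
    exact subset_rfl
  have h₀ : ind (0 : Fin 1) ∅ = 0 := ind_of_notMem fun h => h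
  have h₁ : ind 0 (I.1ᶜ) = 1 := ind_of_mem fun h => h
  let e : limit (coCube K f) ≅ (step (f 0)).obj 1 :=
    asIso (polyProj K f (op I)) ≪≫ cubeOneIso f _ ≪≫ (step (f 0)).mapIso (eqToIso h₁)
  refine ⟨(step (f 0)).map (homOfLE h₀.ge) ≫ (cubeOneIso f _).inv, e,
    (Coh.map_of_le_of_le (step (f 0)) (homOfLE h₀.ge) h₀.le).comp (Coh.rightUnitor_inv _), ?_⟩
  change (step (f 0)).map (homOfLE (Fin.zero_le 1)) = ((step (f 0)).map (homOfLE h₀.ge) ≫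
    (cubeOneIso f ∅).inv) ≫ polyIn K f ≫ e.hom
  simp only [e, Iso.trans_hom, asIso_hom, Functor.mapIso_hom, Category.assoc]
  rw [reassoc_of% (polyIn_proj (op I) (homOfLE (Set.empty_subset _))), cube_one_map]
  simp only [Category.assoc, Iso.inv_hom_id_assoc, ← Functor.map_comp]
  rfl

end units

/-! ### Partial compositions -/

section composition

attribute [local instance] CategoryStruct.toQuiver

variable {C : Type u} [Category.{v} C] [MonoidalCategory C]

section stepLift

variable {Q : Type} [SmallCategory Q] {m : ℕ} {f : Fin m → Arrow C} {F : Arrow C}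
  {B : Fin 2 × Q ⥤ Set (Fin m)}
  (l : ∀ q, F.left ⟶ (cube f).obj (B.obj (0, q))) (r : ∀ q, F.right ⟶ (cube f).obj (B.obj (1, q)))
  (w : ∀ q (p : B.obj (0, q) ⟶ B.obj (1, q)), F.hom ≫ r q = l q ≫ (cube f).map p)

/-- Morphisms from the two ends of `F` to the vertices `B (0, q)` and `B (1, q)` of a cube, as a
transformation in the end. -/
noncomputable def stepLift (q : Q) : step F ⟶ (Prod.sectL (Fin 2) q ⋙ B) ⋙ cube f :=
  ComposableArrows.homMk₁ (l q) (r q) (w q _)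

theorem stepLift_naturality
    (nl : ∀ {q q'} (_ : q ⟶ q') (p : B.obj (0, q) ⟶ B.obj (0, q')), l q ≫ (cube f).map p = l q')
    (nr : ∀ {q q'} (_ : q ⟶ q') (p : B.obj (1, q) ⟶ B.obj (1, q')), r q ≫ (cube f).map p = r q')
    {b b' : Fin 2} (p : b ⟶ b') {q q' : Q} (g : q ⟶ q') :
    (stepLift l r w q).app b ≫ (cube f).map (B.map (Prod.mkHom p g)) =
      (step F).map p ≫ (stepLift l r w q').app b' := by
  have key : ∀ b, (stepLift l r w q).app b ≫ (cube f).map (B.map (Prod.mkHom (𝟙 b) g)) =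
      (stepLift l r w q').app b := Fin.forall_fin_two.2 ⟨nl g _, nr g _⟩
  rw [← key b']
  refine Eq.trans ?_ ((stepLift l r w q).naturality_assoc p _).symm
  exact congrArg (_ ≫ ·) (cube_map_trans f _ _ _).symm

end stepLift

theorem isConnected_face {n : ℕ} (K : SComplex n) : IsConnected K.Faceᵒᵖ :=
  isConnected_of_isTerminal _ (x := op ⟨∅, K.empty_mem⟩) (IsTerminal.ofUniqueHom
    (fun _ => Quiver.Hom.op (homOfLE (Set.empty_subset _))) fun _ _ => Subsingleton.elim _ _)

/-! ### Faces of partial compositions -/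

section complexes

variable {n m N : ℕ} (k : Fin n) (h : N + 1 = n + m) (K : SComplex n) (L : SComplex m)

theorem substFace_mono {I I' : Set (Fin n)} {J J' : Set (Fin m)} (hI : I ⊆ I') (hJ : J ⊆ J') :
    substFace k h I J ⊆ substFace k h I' J' := by
  rintro x (⟨i, hi, h₁, h₂⟩ | ⟨hk, j, h₁, h₂⟩)
  · exact Or.inl ⟨i, hi, hI h₁, h₂⟩
  · exact Or.inr ⟨hI hk, j, hJ h₁, h₂⟩

theorem compl_substFace (I : Set (Fin n)) (J : Set (Fin m)) :
    (substFace k h I J)ᶜ = compFace k h Iᶜ Jᶜ := by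
  refine set_ext_positions k h (fun i hi => ?_) fun j => ?_
  · rw [Set.mem_compl_iff, outer_mem_substFace, outer_mem_compFace, Set.mem_compl_iff]
  · rw [Set.mem_compl_iff, inner_mem_substFace, inner_mem_compFace, Set.mem_compl_iff,
      Set.mem_compl_iff, not_and_or]

theorem compl_compFace (I : Set (Fin n)) (J : Set (Fin m)) :
    (compFace k h I J)ᶜ = substFace k h Iᶜ Jᶜ := by
  rw [← compl_compl (substFace k h Iᶜ Jᶜ), compl_substFace, compl_compl, compl_compl]

/-- The pairs of faces `(I, J)` as faces `I ∘ₖ J` of the substitution. -/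
def substFaces : K.Faceᵒᵖ × L.Faceᵒᵖ ⥤ (K.subst k h L).Faceᵒᵖ where
  obj x := op ⟨substFace k h x.1.unop.1 x.2.unop.1, _, x.1.unop.2, _, x.2.unop.2, rfl⟩
  map p := Quiver.Hom.op (homOfLE
    (substFace_mono k h (leOfHom p.1.unop) (leOfHom p.2.unop)))

/-- The pairs of faces `(I, J)` as faces `I ∘ᶜₖ J` of the composition. -/
def compFaces : K.Faceᵒᵖ × L.Faceᵒᵖ ⥤ (K.comp k h L).Faceᵒᵖ where
  obj x := op ⟨compFace k h x.1.unop.1 x.2.unop.1, _, x.1.unop.2, _, x.2.unop.2, subset_rfl⟩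
  map p := Quiver.Hom.op (homOfLE
    (compFace_mono (leOfHom p.1.unop) (leOfHom p.2.unop)))

/-- The positions of the outer operation other than `k` that lie in `X`. -/
def outerPart (X : Set (Fin N)) : Set (Fin n) := {i | ∃ hi, outerPos k h i hi ∈ X}

/-- The positions of the inserted block that lie in `X`. -/
def innerPart (X : Set (Fin N)) : Set (Fin m) := {j | innerPos k h j ∈ X}

variable {k h}

theorem subset_substFace_iff {X : Set (Fin N)} {I : Set (Fin n)} {J : Set (Fin m)} :
    X ⊆ substFace k h I J ↔
      outerPart k h X ⊆ I ∧ ((innerPart k h X).Nonempty → k ∈ I) ∧ innerPart k h X ⊆ J := by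
  constructor
  · intro hX
    refine ⟨?_, ?_, fun j hj => (inner_mem_substFace.1 (hX hj)).2⟩
    · rintro i ⟨hi, hx⟩
      exact (outer_mem_substFace hi).1 (hX hx)
    · rintro ⟨j, hj⟩
      exact (inner_mem_substFace.1 (hX hj)).1
  · rintro ⟨h₁, h₂, h₃⟩ x hx
    obtain ⟨i, hi, rfl⟩ | ⟨j, rfl⟩ := outer_or_inner k h x
    · exact (outer_mem_substFace hi).2 (h₁ ⟨hi, hx⟩)
    · exact inner_mem_substFace.2 ⟨h₂ ⟨j, hx⟩, h₃ hx⟩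

theorem subset_compFace_iff {X : Set (Fin N)} {I : Set (Fin n)} {J : Set (Fin m)} :
    X ⊆ compFace k h I J ↔ outerPart k h X ⊆ I ∧ (k ∈ I ∨ innerPart k h X ⊆ J) := by
  constructor
  · intro hX
    refine ⟨?_, or_iff_not_imp_left.2 fun hk j hj =>
      (inner_mem_compFace.1 (hX hj)).resolve_left hk⟩
    rintro i ⟨hi, hx⟩
    exact (outer_mem_compFace hi).1 (hX hx)
  · rintro ⟨h₁, h₂⟩ x hx
    obtain ⟨i, hi, rfl⟩ | ⟨j, rfl⟩ := outer_or_inner k h x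
    · exact (outer_mem_compFace hi).2 (h₁ ⟨hi, hx⟩)
    · exact inner_mem_compFace.2 (h₂.imp_right fun h₂ => h₂ hx)

variable {K L}

theorem nonempty_pair_hom {I I' : K.Faceᵒᵖ} {J J' : L.Faceᵒᵖ} (hI : I'.unop.1 ⊆ I.unop.1)
    (hJ : J'.unop.1 ⊆ J.unop.1) : Nonempty ((I, J) ⟶ (I', J')) :=
  ⟨Prod.mkHom (Quiver.Hom.op (homOfLE hI)) (Quiver.Hom.op (homOfLE hJ))⟩

theorem nonempty_face_hom {X Y : K.Faceᵒᵖ} : Nonempty (X ⟶ Y) ↔ Y.unop.1 ⊆ X.unop.1 :=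
  ⟨fun ⟨g⟩ => leOfHom g.unop, fun hX => ⟨Quiver.Hom.op (homOfLE hX)⟩⟩

/-- The pairs of faces whose substitution contains a face `X` have a smallest element. -/
instance : (substFaces k h K L).Initial := by
  refine initial_of_thin _ fun X => ?_
  simp only [nonempty_face_hom]
  obtain ⟨X, I₁, hI₁, J₁, hJ₁, hX⟩ := X
  obtain ⟨o₁, k₁, i₁⟩ := subset_substFace_iff.1 hX.ge
  let I₀ : Set (Fin n) := {i | i ∈ outerPart k h X ∨ i = k ∧ (innerPart k h X).Nonempty}
  have hI₀ : I₀ ∈ K.faces := K.down_closed hI₁ <| by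
    rintro i (hi | ⟨rfl, hi⟩)
    exacts [o₁ hi, k₁ hi]
  have hJ₀ : innerPart k h X ∈ L.faces := L.down_closed hJ₁ i₁
  have h₀ : X ⊆ substFace k h I₀ (innerPart k h X) :=
    subset_substFace_iff.2 ⟨fun i hi => Or.inl hi, fun hi => Or.inr ⟨rfl, hi⟩, subset_rfl⟩
  refine ⟨(op ⟨I₀, hI₀⟩, op ⟨_, hJ₀⟩), h₀, fun p hp => ⟨(op ⟨I₀, hI₀⟩, op ⟨_, hJ₀⟩),
    (op ⟨I₀, hI₀⟩, op ⟨_, hJ₀⟩), h₀, ?_, ⟨𝟙 _⟩, ⟨𝟙 _⟩⟩⟩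
  obtain ⟨o₂, k₂, i₂⟩ := subset_substFace_iff.1 hp
  refine nonempty_pair_hom ?_ i₂
  rintro i (hi | ⟨rfl, hi⟩)
  exacts [o₂ hi, k₂ hi]

/-- The pairs of faces whose composition contains `X` need not have a smallest element, as `X` can
be covered inside the block either by `k ∈ I` or by `J`; but if both ways occur, they are connected
through a pair that does both. -/
instance : (compFaces k h K L).Initial := by
  refine initial_of_thin _ fun X => ?_
  simp only [nonempty_face_hom]
  obtain ⟨X, I₁, hI₁, J₁, hJ₁, hX⟩ := X
  obtain ⟨o₁, k₁⟩ := subset_compFace_iff.1 hX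
  have ho : outerPart k h X ∈ K.faces := K.down_closed hI₁ o₁
  -- The chosen pair covers the block part of `X` by `J` if that part is a face of `L`.
  by_cases hi : innerPart k h X ∈ L.faces
  · have h₀ : X ⊆ compFace k h (outerPart k h X) (innerPart k h X) :=
      subset_compFace_iff.2 ⟨subset_rfl, Or.inr subset_rfl⟩
    refine ⟨(op ⟨_, ho⟩, op ⟨_, hi⟩), h₀, fun p hp => ?_⟩
    obtain ⟨o₂, k₂⟩ := subset_compFace_iff.1 hp
    by_cases hk : k ∈ p.1.unop.1
    · refine ⟨(p.1, op ⟨∅, L.empty_mem⟩), (p.1, op ⟨_, hi⟩),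
        subset_compFace_iff.2 ⟨o₂, Or.inl hk⟩, ?_, ?_, ?_⟩
      · exact nonempty_pair_hom subset_rfl (Set.empty_subset _)
      · exact nonempty_pair_hom subset_rfl (Set.empty_subset _)
      · exact nonempty_pair_hom o₂ subset_rfl
    · exact ⟨(op ⟨_, ho⟩, op ⟨_, hi⟩), (op ⟨_, ho⟩, op ⟨_, hi⟩), h₀,
        nonempty_pair_hom o₂ (k₂.resolve_left hk), ⟨𝟙 _⟩, ⟨𝟙 _⟩⟩
  -- Otherwise `k ∈ I` is forced, and there is a smallest pair.
  · have key : ∀ {I : Set (Fin n)} {J : Set (Fin m)}, J ∈ L.faces → X ⊆ compFace k h I J →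
        insert k (outerPart k h X) ⊆ I := fun {I J} hJ hp => by
      obtain ⟨o₂, k₂⟩ := subset_compFace_iff.1 hp
      exact Set.insert_subset (k₂.resolve_right fun hXJ => hi (L.down_closed hJ hXJ)) o₂
    have hI₀ : insert k (outerPart k h X) ∈ K.faces := K.down_closed hI₁ (key hJ₁ hX)
    have h₀ : X ⊆ compFace k h (insert k (outerPart k h X)) ∅ :=
      subset_compFace_iff.2 ⟨Set.subset_insert _ _, Or.inl (Set.mem_insert _ _)⟩
    exact ⟨(op ⟨_, hI₀⟩, op ⟨∅, L.empty_mem⟩), h₀, fun p hp =>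
      ⟨(op ⟨_, hI₀⟩, op ⟨∅, L.empty_mem⟩), (op ⟨_, hI₀⟩, op ⟨∅, L.empty_mem⟩), h₀,
        nonempty_pair_hom (key p.2.unop.2 hp) (Set.empty_subset _), ⟨𝟙 _⟩, ⟨𝟙 _⟩⟩⟩

end complexes

/-! ### Polyhedral limits of partial compositions -/

section limits

variable [HasFiniteLimits C] [∀ X : C, PreservesFiniteLimits (tensorLeft X)]
  [∀ X : C, PreservesFiniteLimits (tensorRight X)] {n m N : ℕ} (k : Fin n) (h : N + 1 = n + m)
  (K : SComplex n) (L : SComplex m) (f : Fin N → Arrow C)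

/-- The complement of `I ∘ₖ J` is `Iᶜ ∘ᶜₖ Jᶜ`, so that `∘ᶜₖ` gives the vertices relevant to
substitution. -/
def compFaceFunctor : Set (Fin n) × L.Faceᵒᵖ ⥤ Set (Fin N) where
  obj x := compFace k h x.1 x.2.unop.1ᶜ
  map p := homOfLE (compFace_mono (leOfHom p.1) (leOfHom (L.coface.map p.2)))

/-- The complement of `I ∘ᶜₖ J` is `Iᶜ ∘ₖ Jᶜ`, so that `∘ₖ` gives the vertices relevant to
composition. -/
def substFaceFunctor : Set (Fin n) × L.Faceᵒᵖ ⥤ Set (Fin N) where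
  obj x := substFace k h x.1 x.2.unop.1ᶜ
  map p := homOfLE (substFace_mono k h (leOfHom p.1) (leOfHom (L.coface.map p.2)))

/-- The trace of `compFaceFunctor` on the inserted block: the whole block if `b = 1`, and `Jᶜ` if
`b = 0`. -/
def joinFunctor : Fin 2 × L.Faceᵒᵖ ⥤ Set (Fin m) where
  obj x := {j | x.1 = 1 ∨ j ∈ x.2.unop.1ᶜ}
  map p := homOfLE fun _ hj => hj.imp
    (fun e => le_antisymm (Fin.le_last _) (e.ge.trans (leOfHom p.1)))
    fun hj => leOfHom (L.coface.map p.2) hj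

/-- The trace of `substFaceFunctor` on the inserted block: `Jᶜ` if `b = 1`, and nothing if `b = 0`.
-/
def meetFunctor : Fin 2 × L.Faceᵒᵖ ⥤ Set (Fin m) where
  obj x := {j | x.1 = 1 ∧ j ∈ x.2.unop.1ᶜ}
  map p := homOfLE fun _ hj => hj.imp
    (fun e => le_antisymm (Fin.le_last _) (e.ge.trans (leOfHom p.1)))
    fun hj => leOfHom (L.coface.map p.2) hj

theorem ind_eq_one_iff {i : Fin n} {A : Set (Fin n)} : ind i A = 1 ↔ i ∈ A := by
  by_cases hi : i ∈ A
  · simp [ind_of_mem hi, hi]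
  · simp [ind_of_notMem hi, hi]

/-- The domain of `polyLimit L` is the limit over `J` of the vertices `Jᶜ`, and its codomain is
trivially the limit of a constant diagram on a connected category, as `graftMap` requires. -/
theorem cohOver_subst : CohOver (polyLimit (K.subst k h L) f)
    (polyLimit K (graft k h f (polyLimit L fun j => f (innerPos k h j)))) := by
  let fi : Fin m → Arrow C := fun j => f (innerPos k h j)
  have e₀ : ∀ q : L.Faceᵒᵖ, q.unop.1ᶜ = (joinFunctor L).obj (0, q) := fun q => by
    ext j
    simp [joinFunctor]
  have e₁ : ∀ q : L.Faceᵒᵖ, Set.univ = (joinFunctor L).obj (1, q) := fun q => by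
    ext j
    simp [joinFunctor]
  let l : ∀ q, limit (coCube L fi) ⟶ (cube fi).obj ((joinFunctor L).obj (0, q)) := fun q =>
    polyProj L fi q ≫ (cube fi).map (homOfLE (e₀ q).le)
  let r : ∀ q, (cube fi).obj Set.univ ⟶ (cube fi).obj ((joinFunctor L).obj (1, q)) := fun q =>
    (cube fi).map (homOfLE (e₁ q).le)
  have w : ∀ q (p : (joinFunctor L).obj (0, q) ⟶ (joinFunctor L).obj (1, q)),
      polyOut L fi ≫ r q = l q ≫ (cube fi).map p := fun q p => by
    rw [← polyProj_map_univ q (homOfLE (Set.subset_univ _)), Category.assoc, Category.assoc,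
      cube_map_comm]
  let F : Arrow C := polyLimit L fi
  have nl : ∀ {q q' : L.Faceᵒᵖ} (_ : q ⟶ q') (p : (joinFunctor L).obj (0, q) ⟶
      (joinFunctor L).obj (0, q')), l q ≫ (cube fi).map p = l q' := fun {q q'} g p => by
    dsimp only [l, r]
    rw [← polyProj_map (L.coface.map g), Category.assoc, Category.assoc]
    exact congrArg (_ ≫ ·) (cube_map_comm fi _ _ _ _)
  have nr : ∀ {q q' : L.Faceᵒᵖ} (_ : q ⟶ q') (p : (joinFunctor L).obj (1, q) ⟶
      (joinFunctor L).obj (1, q')), r q ≫ (cube fi).map p = r q' := fun _ p =>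
    cube_map_trans fi _ p _
  let Ψ : ∀ b q, (step F).obj b ⟶ (cube fi).obj ((joinFunctor L).obj (b, q)) := fun b q =>
    (stepLift (F := F) l r w q).app b
  have nat : ∀ {b b' : Fin 2} (p : b ⟶ b') {q q' : L.Faceᵒᵖ} (g : q ⟶ q'),
      Ψ b q ≫ (cube fi).map ((joinFunctor L).map (Prod.mkHom p g)) = (step F).map p ≫ Ψ b' q' :=
    fun p _ _ g => stepLift_naturality (F := F) l r w nl nr p g
  have cohr : ∀ q, Coh (r q) := fun q => Coh.map_of_le_of_le _ _ (e₁ q).ge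
  have hlim : ∀ b, Nonempty (IsLimit (partialCone (cube fi) (joinFunctor L) b (Ψ b)
      fun g => by rw [nat, CategoryTheory.Functor.map_id, Category.id_comp])) := by
    refine Fin.forall_fin_two.2 ⟨?_, ?_⟩
    · refine ⟨isLimitOfIso (limit.isLimit (coCube L fi)) (Iso.refl _) (NatIso.ofComponents
        (fun q => (cube fi).mapIso (eqToIso (e₀ q))) fun g => cube_map_comm fi _ _ _ _) fun q => ?_⟩
      exact Category.id_comp _
    · have := isConnected_face L
      exact nonempty_isLimit_of_isIso_legs _ fun q => (cohr q).1
  have out : ∀ A q i hi, outerPos k h i hi ∈ (compFaceFunctor k h L).obj (A, q) ↔ i ∈ A :=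
    fun _ _ _ hi => outer_mem_compFace hi
  have inn : ∀ A q j, innerPos k h j ∈ (compFaceFunctor k h L).obj (A, q) ↔
      j ∈ (joinFunctor L).obj (ind k A, q) := fun A q j =>
    inner_mem_compFace.trans (or_congr_left ind_eq_one_iff.symm)
  let q₀ : L.Faceᵒᵖ := op ⟨∅, L.empty_mem⟩
  obtain ⟨e, he⟩ := exists_iso_polyOut (M := K.subst k h L) (K := K) _ _
    (graftMap_naturality k h f F (joinFunctor L) Ψ (compFaceFunctor k h L) out inn nat)
    (nonempty_isLimit_graftMap k h f F (joinFunctor L) Ψ (compFaceFunctor k h L) out inn nat hlim)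
    (substFaces k h K L) (fun I q => compl_substFace k h I.unop.1 q.unop.1) q₀
  have cohΨ : ∀ b, b = 1 → Coh (Ψ b q₀) := by
    rintro _ rfl
    exact cohr q₀
  refine ⟨e, _, ?_, he⟩
  refine (coh_graftMap k h f F _ Ψ _ out inn Set.univ q₀ (cohΨ _ (ind_of_mem trivial))).comp
    (Coh.map_of_le_of_le _ _ ?_)
  intro x _
  obtain ⟨i, hi, rfl⟩ | ⟨j, rfl⟩ := outer_or_inner k h x
  · exact (out _ _ i hi).2 trivial
  · exact (inn _ _ j).2 (Or.inl (ind_of_mem trivial))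

/-- Here the domain is the limit of a constant diagram, and the codomain the limit over the
vertices `Jᶜ`. -/
theorem cohUnder_comp : CohUnder (polyLimitComp (K.comp k h L) f)
    (polyLimitComp K (graft k h f (polyLimitComp L fun j => f (innerPos k h j)))) := by
  let fi : Fin m → Arrow C := fun j => f (innerPos k h j)
  have e₀ : ∀ q : L.Faceᵒᵖ, ∅ = (meetFunctor L).obj (0, q) := fun q => by
    ext j
    simp [meetFunctor]
  have e₁ : ∀ q : L.Faceᵒᵖ, q.unop.1ᶜ = (meetFunctor L).obj (1, q) := fun q => by
    ext j
    simp [meetFunctor]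
  let l : ∀ q, (cube fi).obj ∅ ⟶ (cube fi).obj ((meetFunctor L).obj (0, q)) := fun q =>
    (cube fi).map (homOfLE (e₀ q).le)
  let r : ∀ q, limit (coCube L fi) ⟶ (cube fi).obj ((meetFunctor L).obj (1, q)) := fun q =>
    polyProj L fi q ≫ (cube fi).map (homOfLE (e₁ q).le)
  have w : ∀ q (p : (meetFunctor L).obj (0, q) ⟶ (meetFunctor L).obj (1, q)),
      polyIn L fi ≫ r q = l q ≫ (cube fi).map p := fun q p => by
    rw [reassoc_of% (polyIn_proj q (homOfLE (Set.empty_subset _))), cube_map_comm]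
  let F : Arrow C := polyLimitComp L fi
  have nl : ∀ {q q' : L.Faceᵒᵖ} (_ : q ⟶ q') (p : (meetFunctor L).obj (0, q) ⟶
      (meetFunctor L).obj (0, q')), l q ≫ (cube fi).map p = l q' := fun _ p =>
    cube_map_trans fi _ p _
  have nr : ∀ {q q' : L.Faceᵒᵖ} (_ : q ⟶ q') (p : (meetFunctor L).obj (1, q) ⟶
      (meetFunctor L).obj (1, q')), r q ≫ (cube fi).map p = r q' := fun {q q'} g p => by
    dsimp only [l, r]
    rw [← polyProj_map (L.coface.map g), Category.assoc, Category.assoc]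
    exact congrArg (_ ≫ ·) (cube_map_comm fi _ _ _ _)
  let Ψ : ∀ b q, (step F).obj b ⟶ (cube fi).obj ((meetFunctor L).obj (b, q)) := fun b q =>
    (stepLift (F := F) l r w q).app b
  have nat : ∀ {b b' : Fin 2} (p : b ⟶ b') {q q' : L.Faceᵒᵖ} (g : q ⟶ q'),
      Ψ b q ≫ (cube fi).map ((meetFunctor L).map (Prod.mkHom p g)) = (step F).map p ≫ Ψ b' q' :=
    fun p _ _ g => stepLift_naturality (F := F) l r w nl nr p g
  have cohl : ∀ q, Coh (l q) := fun q => Coh.map_of_le_of_le _ _ (e₀ q).ge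
  have hlim : ∀ b, Nonempty (IsLimit (partialCone (cube fi) (meetFunctor L) b (Ψ b)
      fun g => by rw [nat, CategoryTheory.Functor.map_id, Category.id_comp])) := by
    refine Fin.forall_fin_two.2 ⟨?_, ?_⟩
    · have := isConnected_face L
      exact nonempty_isLimit_of_isIso_legs _ fun q => (cohl q).1
    · refine ⟨isLimitOfIso (limit.isLimit (coCube L fi)) (Iso.refl _) (NatIso.ofComponents
        (fun q => (cube fi).mapIso (eqToIso (e₁ q))) fun g => cube_map_comm fi _ _ _ _) fun q => ?_⟩
      exact Category.id_comp _
  have out : ∀ A q i hi, outerPos k h i hi ∈ (substFaceFunctor k h L).obj (A, q) ↔ i ∈ A :=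
    fun _ _ _ hi => outer_mem_substFace hi
  have inn : ∀ A q j, innerPos k h j ∈ (substFaceFunctor k h L).obj (A, q) ↔
      j ∈ (meetFunctor L).obj (ind k A, q) := fun A q j =>
    inner_mem_substFace.trans (and_congr_left fun _ => ind_eq_one_iff.symm)
  let q₀ : L.Faceᵒᵖ := op ⟨∅, L.empty_mem⟩
  have hT : (substFaceFunctor k h L).obj (∅, q₀) = ∅ :=
    Set.subset_empty_iff.1 (by rintro x (⟨_, _, hx, _⟩ | ⟨hx, _⟩) <;> exact hx)
  obtain ⟨e, he⟩ := exists_iso_polyIn (M := K.comp k h L) (K := K) _ _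
    (graftMap_naturality k h f F (meetFunctor L) Ψ (substFaceFunctor k h L) out inn nat)
    (nonempty_isLimit_graftMap k h f F (meetFunctor L) Ψ (substFaceFunctor k h L) out inn nat hlim)
    (compFaces k h K L) (fun I q => compl_compFace k h I.unop.1 q.unop.1) q₀
    (fun q => ⟨Quiver.Hom.op (homOfLE (Set.empty_subset _))⟩) hT
  have cohΨ : ∀ b, b = 0 → Coh (Ψ b q₀) := by
    rintro _ rfl
    exact cohl q₀
  refine ⟨_, e, ?_, he⟩
  exact (coh_graftMap k h f F _ Ψ _ out inn ∅ q₀ (cohΨ _ (ind_of_notMem fun hk => hk))).comp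
    (Coh.map_of_le_of_le _ _ hT.ge)

end limits

end composition

/-! ### The algebra structures -/

section algebra

variable {C : Type u} [Category.{v} C] [MonoidalCategory C] [SymmetricCategory C]

variable [HasFiniteLimits C]

theorem arrowClass_polyLimit_congr {n : ℕ} (K : SComplex n) {f g : Fin n → Arrow C}
    (h : ∀ i, arrowClass (g i) = arrowClass (f i)) :
    arrowClass (polyLimit K f) = arrowClass (polyLimit K g) ∧
      arrowClass (polyLimitComp K f) = arrowClass (polyLimitComp K g) := by
  have := arrowClass_polyLimit_act K 1 (f := f) (g := g) fun i => (Quotient.exact (h i)).some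
  rwa [SComplex.act_one] at this

/-- The algebra structure given by the polyhedral limits of representatives. -/
noncomputable def substAlgebra [∀ X : C, PreservesFiniteLimits (tensorLeft X)]
    [∀ X : C, PreservesFiniteLimits (tensorRight X)] : substOperad.Algebra (ArrowClass C) where
  app n (K : SComplex n) x := arrowClass (polyLimit K fun i => (x i).out)
  app_act {n} (K : SComplex n) σ := by
    funext x
    exact (arrowClass_polyLimit_act K σ fun i => Iso.refl ((x (σ.symm i)).out)).1
  app_one := by
    funext x
    exact (cohOver_one fun i => (x i).out).arrowClass_eq.trans (Quotient.out_eq _)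
  app_comp {n m N} k h (K : SComplex n) (L : SComplex m) := by
    funext x
    refine (cohOver_subst k h K L fun i => (x i).out).arrowClass_eq.trans
      (arrowClass_polyLimit_congr K fun i => ?_).1
    refine (Quotient.out_eq _).trans ?_
    by_cases hi : i = k
    · subst hi
      rw [graft_self, graft_self]
    · rw [graft_ne _ _ _ _ hi, graft_ne _ _ _ _ hi]
      exact (Quotient.out_eq _).symm

/-- The algebra structure given by the dual polyhedral limits of representatives. -/
noncomputable def compAlgebra [∀ X : C, PreservesFiniteLimits (tensorLeft X)]
    [∀ X : C, PreservesFiniteLimits (tensorRight X)] : compOperad.Algebra (ArrowClass C) where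
  app n (K : SComplex n) x := arrowClass (polyLimitComp K fun i => (x i).out)
  app_act {n} (K : SComplex n) σ := by
    funext x
    exact (arrowClass_polyLimit_act K σ fun i => Iso.refl ((x (σ.symm i)).out)).2
  app_one := by
    funext x
    exact (cohUnder_one fun i => (x i).out).arrowClass_eq.trans (Quotient.out_eq _)
  app_comp {n m N} k h (K : SComplex n) (L : SComplex m) := by
    funext x
    refine (cohUnder_comp k h K L fun i => (x i).out).arrowClass_eq.trans
      (arrowClass_polyLimit_congr K fun i => ?_).2
    refine (Quotient.out_eq _).trans ?_
    by_cases hi : i = k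
    · subst hi
      rw [graft_self, graft_self]
    · rw [graft_ne _ _ _ _ hi, graft_ne _ _ _ _ hi]
      exact (Quotient.out_eq _).symm

end algebra

end PolyLim

theorem theorem3p17 {C : Type u} [Category.{v} C] [MonoidalCategory C] [SymmetricCategory C]
    [HasFiniteLimits C]
    [∀ X : C, PreservesFiniteLimits (tensorLeft X)]
    [∀ X : C, PreservesFiniteLimits (tensorRight X)] :
    (∃ A : substOperad.Algebra (ArrowClass C),
      ∀ (n : ℕ) (K : SComplex n) (f : Fin n → Arrow C),
        A.app n K (fun i => arrowClass (f i)) = arrowClass (polyLimit K f)) ∧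
    (∃ A : compOperad.Algebra (ArrowClass C),
      ∀ (n : ℕ) (K : SComplex n) (f : Fin n → Arrow C),
        A.app n K (fun i => arrowClass (f i)) = arrowClass (polyLimitComp K f)) ∧
    (IsStrict C →
      (∀ f : Fin 1 → Arrow C, SameOver (polyLimit substOperad.one f) (f 0)) ∧
      (∀ {n m N : ℕ} (k : Fin n) (h : N + 1 = n + m) (K : SComplex n) (L : SComplex m)
        (f : Fin N → Arrow C),
        SameOver (polyLimit (K.subst k h L) f)
          (polyLimit K (graft k h f (polyLimit L (fun j => f (innerPos k h j)))))) ∧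
      (∀ f : Fin 1 → Arrow C, SameUnder (polyLimitComp compOperad.one f) (f 0)) ∧
      (∀ {n m N : ℕ} (k : Fin n) (h : N + 1 = n + m) (K : SComplex n) (L : SComplex m)
        (f : Fin N → Arrow C),
        SameUnder (polyLimitComp (K.comp k h L) f)
          (polyLimitComp K (graft k h f (polyLimitComp L (fun j => f (innerPos k h j))))))) := by
  refine ⟨⟨substAlgebra, fun n K f => (arrowClass_polyLimit_congr K fun i => ?_).1⟩,
    ⟨compAlgebra, fun n K f => (arrowClass_polyLimit_congr K fun i => ?_).2⟩, fun hC =>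
    ⟨fun f => (cohOver_one f).sameOver hC,
      fun k h K L f => (cohOver_subst k h K L f).sameOver hC,
      fun f => (cohUnder_one f).sameUnder hC,
      fun k h K L f => (cohUnder_comp k h K L f).sameUnder hC⟩⟩
  · exact (Quotient.out_eq (arrowClass (f i))).symm
  · exact (Quotient.out_eq (arrowClass (f i))).symm
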